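/- Let $m,n\ge 2$. A skew-quad (SQ) surface of size $m\times n$ is a map $f:\{0,\dots,m\}\times\{0,\dots,n\}\to\mathbb{R}^3$; its quads are the $mn$ quadruples $f(i,j),f(i+1,j),f(i+1,j+1),f(i,j+1)$ with $0\le i<m$, $0\le j<n$, and these need not be planar. The surface is non-degenerate if at every inner vertex $f(i,j)$, $0<i<m$, $0<j<n$, no three of the four edge vectors $f(i\pm1,j)-f(i,j)$, $f(i,j\pm1)-f(i,j)$ are linearly dependent (that is, no three of the four edges are coplanar). The surface is continuously flexible if there is a continuous family $(f_t)_{t\in[0,1]}$ of SQ surfaces of the same size with $f_0=f$ such that for every $t$ each quad of $f_t$ is congruent to the corresponding quad of $f$ (all six distances between its four vertices agree), while for some $t$ the whole surface $f_t$ is not congruent to $f$ (some distance between two vertices has changed). A $(3\times3)$ building block of $f$ is the SQ surface of size $3\times 3$ given by the restriction of $f$ to $\{a,\dots,a+3\}\times\{b,\dots,b+3\}$ for integers $0\le a\le m-3$, $0\le b\le n-3$. Theorem. A non-degenerate SQ surface of size $m\times n$ is continuously flexible if and only if each of its $(3\times3)$ building blocks is continuously flexible. -/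

import Mathlib

/-- Euclidean three-space. -/
abbrev E3 : Type := EuclideanSpace ℝ (Fin 3)

/-- A quad surface with the combinatorics of an `m × n` square grid: a position in space for each
of the `(m + 1) × (n + 1)` vertices. The `m * n` quads may be skew: no planarity is required. -/
abbrev QuadSurface (m n : ℕ) : Type := Fin (m + 1) × Fin (n + 1) → E3

/-- The four vertices of the quad in position `(i, j)`. -/
def quadVertices {m n : ℕ} (i : Fin m) (j : Fin n) : Set (Fin (m + 1) × Fin (n + 1)) :=
  {p | (p.1 = i.castSucc ∨ p.1 = i.succ) ∧ (p.2 = j.castSucc ∨ p.2 = j.succ)}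

/-- The four edge vectors, in cyclic order, emanating from the inner vertex `(i + 1, j + 1)`. -/
def edgeStar {m n : ℕ} (f : QuadSurface m n) (i j : ℕ) (hi : i + 2 ≤ m) (hj : j + 2 ≤ n) :
    Fin 4 → E3 :=
  let c := f (⟨i + 1, by omega⟩, ⟨j + 1, by omega⟩)
  ![f (⟨i + 2, by omega⟩, ⟨j + 1, by omega⟩) - c,
    f (⟨i + 1, by omega⟩, ⟨j + 2, by omega⟩) - c,
    f (⟨i, by omega⟩, ⟨j + 1, by omega⟩) - c,
    f (⟨i + 1, by omega⟩, ⟨j, by omega⟩) - c]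

/-- A quad surface is non-degenerate if, at every inner vertex, no three of the four edges
are coplanar. -/
def NonDegenerate {m n : ℕ} (f : QuadSurface m n) : Prop :=
  ∀ (i j : ℕ) (hi : i + 2 ≤ m) (hj : j + 2 ≤ n) (k : Fin 4),
    LinearIndependent ℝ (fun l : Fin 3 => edgeStar f i j hi hj (k.succAbove l))

/-- `F` restricted to `[0, 1]` is a continuous motion starting at `f` during which every quad stays
rigid: all distances between its four vertices, diagonals included, are preserved. (By continuity
a skew quad then never turns into its mirror image, so it undergoes proper rigid motions.) -/
structure IsMotion {m n : ℕ} (f : QuadSurface m n) (F : ℝ → QuadSurface m n) : Prop where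
  continuousOn : ContinuousOn F (Set.Icc 0 1)
  start : F 0 = f
  rigid : ∀ t ∈ Set.Icc (0 : ℝ) 1, ∀ (i : Fin m) (j : Fin n),
    ∀ p ∈ quadVertices i j, ∀ q ∈ quadVertices i j, dist (F t p) (F t q) = dist (f p) (f q)

/-- Two quad surfaces are congruent if all distances between their vertices agree. -/
def IsCongruent {m n : ℕ} (f g : QuadSurface m n) : Prop :=
  ∀ p q, dist (f p) (f q) = dist (g p) (g q)

/-- A quad surface is continuously flexible if it admits a continuous motion with rigid quads that
does not move the surface as a whole like a rigid body. -/
def ContinuouslyFlexible {m n : ℕ} (f : QuadSurface m n) : Prop :=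
  ∃ F : ℝ → QuadSurface m n, IsMotion f F ∧ ∃ t ∈ Set.Icc (0 : ℝ) 1, ¬ IsCongruent (F t) f

/-- The `3 × 3` building block formed by the quads `(a + i, b + j)` with `i, j ∈ {0, 1, 2}`. -/
def buildingBlock {m n : ℕ} (f : QuadSurface m n) (a b : ℕ) (ha : a + 3 ≤ m) (hb : b + 3 ≤ n) :
    QuadSurface 3 3 :=
  fun p => f (⟨a + p.1, by omega⟩, ⟨b + p.2, by omega⟩)

/-! A surface with rigid quads has at most one degree of freedom near a non-degenerate position. The
star of an inner vertex is a spherical four-bar linkage; as long as the orientation determinants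
keep their nonzero signs, the angle between one pair of opposite edges determines that between the
other pair (`SameLink.dot_eq`). Two quads sharing an edge form a hinge, so the angle at one end of
the edge determines the angle at the other end (`hinge`). Hence agreement of two compatible surfaces
in one `rowDot` spreads to all inner vertices (`Compat.rowDot_iff`) and makes the surfaces properly
congruent (`Compat.exists_isRotation`). It follows that a nontrivial motion changes the angle at
every inner vertex (`IsMotion.exists_rowDot_ne`), so its restriction to any block is still
nontrivial.

For the converse, an analytic deformation (`Germ`) is built whose parameter `s` is the change of
`rowDot` at the vertex `(1, 1)`. A strip of size `2 × n` always has one: every further column is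
found by trilateration and rigid completion (`Germ.succ_col`). In a further row, each inner vertex
is trilaterated over two edges of the previous row, and the two end vertices complete rigid quads.
Only the distances between consecutive inner vertices of the new row are in doubt.

Each such distance lies in one `3 × 3` block. The motion of the block reaches compatible shapes
whose angle differs from the initial one by arbitrarily little but not by zero. The angle of the
germ takes all values near the initial one (`Germ.exists_rowDot_eq`), so at some `s ≠ 0` arbitrarily
close to `0` germ and block agree in an angle. They then agree up to a rotation, without using the
last row of quads (`SkelCompat.dot_eq`), and the distance is right at this `s`. Since the squared
distance is analytic in `s`, the identity theorem makes it constant near `0`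
(`Germ.eventually_edge`). -/

namespace SkewQuad

open Set Filter Topology

/-! ### Vector algebra: Gram determinants, orientation and rotations -/

/-- The dot product in coordinates. -/
def dot (a b : E3) : ℝ := a 0 * b 0 + a 1 * b 1 + a 2 * b 2

/-- The vector product. -/
def cross (a b : E3) : E3 :=
  !₂[a 1 * b 2 - a 2 * b 1, a 2 * b 0 - a 0 * b 2, a 0 * b 1 - a 1 * b 0]

/-- The determinant of three vectors. -/
def det3 (a b c : E3) : ℝ :=
  a 0 * (b 1 * c 2 - b 2 * c 1) - a 1 * (b 0 * c 2 - b 2 * c 0) + a 2 * (b 0 * c 1 - b 1 * c 0)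

/-- The Gram determinant of two vectors. -/
def gram2 (a b : E3) : ℝ := dot a a * dot b b - dot a b ^ 2

@[simp] lemma cross_zero (a b : E3) : cross a b 0 = a 1 * b 2 - a 2 * b 1 := rfl
@[simp] lemma cross_one (a b : E3) : cross a b 1 = a 2 * b 0 - a 0 * b 2 := rfl
@[simp] lemma cross_two (a b : E3) : cross a b 2 = a 0 * b 1 - a 1 * b 0 := rfl

lemma E3.ext {a b : E3} (h0 : a 0 = b 0) (h1 : a 1 = b 1) (h2 : a 2 = b 2) : a = b := by
  ext i
  fin_cases i
  · exact h0
  · exact h1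
  · exact h2

lemma dist_sq_eq (a b : E3) : dist a b ^ 2 = dot (a - b) (a - b) := by
  rw [EuclideanSpace.dist_eq, Real.sq_sqrt (by positivity)]
  simp [Fin.sum_univ_three, dot, Real.dist_eq, sq_abs]
  ring

lemma dist_eq_dist_iff {a b a' b' : E3} :
    dist a b = dist a' b' ↔ dot (a - b) (a - b) = dot (a' - b') (a' - b') := by
  rw [← dist_sq_eq, ← dist_sq_eq, sq_eq_sq₀ dist_nonneg dist_nonneg]

lemma dot_comm (a b : E3) : dot a b = dot b a := by simp only [dot]; ring

lemma gram2_comm (a b : E3) : gram2 a b = gram2 b a := by simp only [gram2, dot]; ring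

lemma dot_sub_sub (a b : E3) : dot (a - b) (a - b) = dot a a + dot b b - 2 * dot a b := by
  simp only [dot, PiLp.sub_apply]; ring

lemma det3_mul_det3 (a b c x y z : E3) :
    det3 a b c * det3 x y z =
      dot a x * (dot b y * dot c z - dot b z * dot c y)
      - dot a y * (dot b x * dot c z - dot b z * dot c x)
      + dot a z * (dot b x * dot c y - dot b y * dot c x) := by
  simp only [det3, dot]; ring

lemma gram2_eq (a b : E3) :
    gram2 a b = cross a b 0 ^ 2 + cross a b 1 ^ 2 + cross a b 2 ^ 2 := by
  simp only [gram2, dot, cross_zero, cross_one, cross_two]; ring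

lemma gram2_ne_zero {a b c : E3} (h : det3 a b c ≠ 0) : gram2 a b ≠ 0 := by
  intro h0
  rw [gram2_eq] at h0
  have e0 : cross a b 0 = 0 := by
    nlinarith [sq_nonneg (cross a b 0), sq_nonneg (cross a b 1), sq_nonneg (cross a b 2)]
  have e1 : cross a b 1 = 0 := by
    nlinarith [sq_nonneg (cross a b 0), sq_nonneg (cross a b 1), sq_nonneg (cross a b 2)]
  have e2 : cross a b 2 = 0 := by
    nlinarith [sq_nonneg (cross a b 0), sq_nonneg (cross a b 1), sq_nonneg (cross a b 2)]
  apply h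
  have : det3 a b c = cross a b 0 * c 0 + cross a b 1 * c 1 + cross a b 2 * c 2 := by
    simp only [det3, cross_zero, cross_one, cross_two]; ring
  rw [this, e0, e1, e2]; ring

/-- With `n = u × v`, the vectors `v × n`, `n × u`, `n` are `gram2 u v` times the dual basis of `u`,
`v`, `n`, and `det3 u v z` is the dot product of `z` with `n`. -/
lemma gram2_smul_eq (u v z : E3) :
    gram2 u v • z = dot z u • cross v (cross u v) + dot z v • cross (cross u v) u
      + det3 u v z • cross u v := by
  apply E3.ext <;>
  simp [gram2, dot, det3] <;> ring

lemma eq_of_dot_eq_of_det3_eq {u v z z' : E3} (h : gram2 u v ≠ 0) (hu : dot z u = dot z' u)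
    (hv : dot z v = dot z' v) (hd : det3 u v z = det3 u v z') : z = z' := by
  have h1 := gram2_smul_eq u v z
  rw [hu, hv, hd, ← gram2_smul_eq u v z'] at h1
  exact smul_right_injective _ h h1

lemma eq_of_sq_eq_of_mul_pos {a b : ℝ} (h : a * a = b * b) (hp : 0 < a * b) : a = b := by
  rcases mul_self_eq_mul_self_iff.1 h with h | h
  · exact h
  · subst h; nlinarith [mul_self_nonneg b]

/-- By `det3_mul_det3` the square of a determinant is the Gram determinant of its vectors, so the
dot products fix it up to sign. -/
lemma det3_eq_of_dot_eq {a b c a' b' c' : E3} (haa : dot a a = dot a' a') (hbb : dot b b = dot b' b')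
    (hcc : dot c c = dot c' c') (hab : dot a b = dot a' b') (hac : dot a c = dot a' c')
    (hbc : dot b c = dot b' c') (hp : 0 < det3 a b c * det3 a' b' c') :
    det3 a b c = det3 a' b' c' := by
  apply eq_of_sq_eq_of_mul_pos _ hp
  rw [det3_mul_det3, det3_mul_det3, dot_comm b a, dot_comm c a, dot_comm c b, dot_comm b' a',
    dot_comm c' a', dot_comm c' b', haa, hbb, hcc, hab, hac, hbc]

/-- Trilateration: the dot products and the length leave two candidates, mirror images in the plane
of `u` and `v`, and the sign of the determinant chooses between them. -/
lemma eq_of_dot_eq_of_det3_pos {u v z z' : E3} (hu : dot z u = dot z' u) (hv : dot z v = dot z' v)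
    (hz : dot z z = dot z' z') (hd : 0 < det3 u v z * det3 u v z') : z = z' := by
  have h : gram2 u v ≠ 0 := gram2_ne_zero (left_ne_zero_of_mul hd.ne')
  refine eq_of_dot_eq_of_det3_eq h hu hv (det3_eq_of_dot_eq rfl rfl hz rfl ?_ ?_ hd)
  · rw [dot_comm, hu, dot_comm]
  · rw [dot_comm, hv, dot_comm]

/-- An additive map preserving dot products and determinants: a rotation. -/
structure IsRotation (T : E3 → E3) : Prop where
  map_sub : ∀ x y, T (x - y) = T x - T y
  map_dot : ∀ x y, dot (T x) (T y) = dot x y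
  map_det3 : ∀ x y z, det3 (T x) (T y) (T z) = det3 x y z

/-- Splits `dot x y`, up to the factor `gram2 u v`, into the contribution of the plane of `u`, `v`
and that of its normal. -/
lemma gram2_mul_dot (u v x y : E3) :
    gram2 u v * dot x y = dot x u * dot y u * dot v v + dot x v * dot y v * dot u u
      - (dot x u * dot y v + dot x v * dot y u) * dot u v + det3 u v x * det3 u v y := by
  simp only [gram2, dot, det3]; ring

lemma gram2_mul_dot_frame (u v : E3) (p q r p' q' r' : ℝ) :
    dot (p • cross v (cross u v) + q • cross (cross u v) u + r • cross u v)
        (p' • cross v (cross u v) + q' • cross (cross u v) u + r' • cross u v) =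
      gram2 u v * (p * p' * dot v v + q * q' * dot u u - (p * q' + q * p') * dot u v + r * r') := by
  simp [gram2, dot]; ring

lemma exists_isRotation {u v u' v' : E3} (huu : dot u u = dot u' u') (hvv : dot v v = dot v' v')
    (huv : dot u v = dot u' v') (h : gram2 u v ≠ 0) :
    ∃ T, IsRotation T ∧ T u = u' ∧ T v = v' := by
  have hg : gram2 u' v' = gram2 u v := by simp only [gram2, huu, hvv, huv]
  -- The rotation reads off the coordinates of `z` in the frame of `u`, `v` as in `gram2_smul_eq`
  -- and uses them in the frame of `u'`, `v'`.
  set N := gram2 u v with hN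
  let W : E3 → E3 := fun z => dot z u • cross v' (cross u' v') + dot z v • cross (cross u' v') u'
      + det3 u v z • cross u' v'
  have key : ∀ z z', dot z u = dot z' u' → dot z v = dot z' v' → det3 u v z = det3 u' v' z' →
      N⁻¹ • W z = z' := by
    intro z z' h1 h2 h3
    have := gram2_smul_eq u' v' z'
    rw [← h1, ← h2, ← h3, hg] at this
    rw [inv_smul_eq_iff₀ h, this]
  have hdot : ∀ x y, dot (N⁻¹ • W x) (N⁻¹ • W y) = dot x y := by
    intro x y
    have h1 : dot (N⁻¹ • W x) (N⁻¹ • W y) = N⁻¹ * N⁻¹ * dot (W x) (W y) := by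
      simp only [dot, PiLp.smul_apply, smul_eq_mul]; ring
    have h2 := gram2_mul_dot u v x y
    rw [h1, gram2_mul_dot_frame, hg, ← huu, ← hvv, ← huv, ← h2, ← hN]
    field_simp
  have hu : N⁻¹ • W u = u' := key u u' huu huv (by simp only [det3]; ring)
  have hv : N⁻¹ • W v = v' := by
    apply key v v' _ hvv (by simp only [det3]; ring)
    rw [dot_comm v, dot_comm v', huv]
  have hcc : ∀ a b : E3, det3 a b (cross a b) = gram2 a b := by
    intro a b; simp only [det3, gram2, dot, cross_zero, cross_one, cross_two]; ring
  have hn : N⁻¹ • W (cross u v) = cross u' v' := by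
    apply key
    · simp only [dot, cross_zero, cross_one, cross_two]; ring
    · simp only [dot, cross_zero, cross_one, cross_two]; ring
    · rw [hcc, hcc, hg]
  refine ⟨fun z => N⁻¹ • W z, ⟨?_, hdot, ?_⟩, hu, hv⟩
  · intro x y
    apply E3.ext <;>
    simp [W, dot, det3] <;> ring
  · intro x y z
    -- A product of two determinants is a polynomial in dot products, hence preserved. Taking `u`,
    -- `v`, `u × v` as second triple, whose determinant `N` is known to be preserved, allows
    -- cancellation.
    have h1 := det3_mul_det3 (N⁻¹ • W x) (N⁻¹ • W y) (N⁻¹ • W z) (N⁻¹ • W u) (N⁻¹ • W v)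
      (N⁻¹ • W (cross u v))
    simp only [hdot] at h1
    rw [← det3_mul_det3, hu, hv, hn, hcc, hcc, hg] at h1
    exact mul_right_cancel₀ h h1

/-! ### Local rigidity: vertex stars, quads and hinges -/

/-- Two closed spherical quadrilaterals with the same side lengths and the same orientations of all
triples of consecutive vertices. -/
structure SameLink (a b c d a' b' c' d' : E3) : Prop where
  aa : dot a a = dot a' a'
  bb : dot b b = dot b' b'
  cc : dot c c = dot c' c'
  dd : dot d d = dot d' d'
  ab : dot a b = dot a' b'
  bc : dot b c = dot b' c'
  cd : dot c d = dot c' d'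
  da : dot d a = dot d' a'
  abc : 0 < det3 a b c * det3 a' b' c'
  bcd : 0 < det3 b c d * det3 b' c' d'
  cda : 0 < det3 c d a * det3 c' d' a'
  dab : 0 < det3 d a b * det3 d' a' b'

namespace SameLink

variable {a b c d a' b' c' d' : E3}

lemma rotate (h : SameLink a b c d a' b' c' d') : SameLink b c d a b' c' d' a' :=
  ⟨h.bb, h.cc, h.dd, h.aa, h.bc, h.cd, h.da, h.ab, h.bcd, h.cda, h.dab, h.abc⟩

/-- Relative to the plane of `a` and `c`, the dot products of `b` and `d` with `a` and `c` are
given, and their heights are fixed by the lengths and by the signs `abc` and `cda`. Then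
`gram2_mul_dot` computes `dot b d`. -/
lemma dot_eq (h : SameLink a b c d a' b' c' d') (hac : dot a c = dot a' c') :
    dot b d = dot b' d' := by
  have h1 := det3_eq_of_dot_eq h.aa h.bb h.cc h.ab hac h.bc h.abc
  have h2 := det3_eq_of_dot_eq h.cc h.dd h.aa h.cd (by rw [dot_comm, hac, dot_comm]) h.da h.cda
  have hg : gram2 a c = gram2 a' c' := by simp only [gram2, h.aa, h.cc, hac]
  have hn : gram2 a c ≠ 0 := by
    apply gram2_ne_zero (c := b)
    have e : det3 a c b = - det3 a b c := by simp only [det3]; ring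
    rw [e]
    exact neg_ne_zero.2 (left_ne_zero_of_mul h.abc.ne')
  have f1 := gram2_mul_dot a c b d
  have f2 := gram2_mul_dot a' c' b' d'
  have e : ∀ a b c d : E3, det3 a c b * det3 a c d = - (det3 a b c * det3 c d a) := by
    intro a b c d; simp only [det3]; ring
  rw [e, h1, h2, dot_comm b a, dot_comm d c, h.ab, h.bc, h.cd, h.da, h.cc, h.aa, hac, ← e,
    dot_comm a' b', dot_comm c' d', ← f2, ← hg] at f1
  exact mul_left_cancel₀ hn f1

lemma dot_eq_iff (h : SameLink a b c d a' b' c' d') :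
    dot a c = dot a' c' ↔ dot b d = dot b' d' :=
  ⟨h.dot_eq, fun e => by rw [dot_comm, h.rotate.dot_eq e, dot_comm]⟩

end SameLink

/-- Two properly congruent tetrahedra, possibly degenerate. -/
structure SameTetra (p q r s p' q' r' s' : E3) : Prop where
  pq : dot (p - q) (p - q) = dot (p' - q') (p' - q')
  pr : dot (p - r) (p - r) = dot (p' - r') (p' - r')
  ps : dot (p - s) (p - s) = dot (p' - s') (p' - s')
  qr : dot (q - r) (q - r) = dot (q' - r') (q' - r')
  qs : dot (q - s) (q - s) = dot (q' - s') (q' - s')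
  rs : dot (r - s) (r - s) = dot (r' - s') (r' - s')
  orient : det3 (q - p) (r - p) (s - p) = det3 (q' - p') (r' - p') (s' - p')

lemma dot_sub_comm (p q : E3) : dot (p - q) (p - q) = dot (q - p) (q - p) := by
  simp only [dot, PiLp.sub_apply]; ring

lemma dot_sub_sub_eq (p q r : E3) : dot (q - p) (r - p) =
    (dot (p - q) (p - q) + dot (p - r) (p - r) - dot (q - r) (q - r)) / 2 := by
  simp only [dot, PiLp.sub_apply]; ring

namespace SameTetra

variable {p q r s p' q' r' s' : E3}

lemma rotate (h : SameTetra p q r s p' q' r' s') : SameTetra q r s p q' r' s' p' := by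
  refine ⟨h.qr, h.qs, ?_, h.rs, ?_, ?_, ?_⟩
  · rw [dot_sub_comm, h.pq, dot_sub_comm]
  · rw [dot_sub_comm, h.pr, dot_sub_comm]
  · rw [dot_sub_comm, h.ps, dot_sub_comm]
  · have e : ∀ p q r s : E3, det3 (r - q) (s - q) (p - q) = - det3 (q - p) (r - p) (s - p) := by
      intro p q r s; simp only [det3, PiLp.sub_apply]; ring
    rw [e p q r s, e p' q' r' s', h.orient]

lemma reverse (h : SameTetra p q r s p' q' r' s') : SameTetra p s r q p' s' r' q' := by
  refine ⟨h.ps, h.pr, h.pq, ?_, ?_, ?_, ?_⟩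
  · rw [dot_sub_comm, h.rs, dot_sub_comm]
  · rw [dot_sub_comm, h.qs, dot_sub_comm]
  · rw [dot_sub_comm, h.qr, dot_sub_comm]
  · have e : ∀ p q r s : E3, det3 (s - p) (r - p) (q - p) = - det3 (q - p) (r - p) (s - p) := by
      intro p q r s; simp only [det3, PiLp.sub_apply]; ring
    rw [e p q r s, e p' q' r' s', h.orient]

lemma dot_qq (h : SameTetra p q r s p' q' r' s') :
    dot (q - p) (q - p) = dot (q' - p') (q' - p') := by
  rw [dot_sub_comm, h.pq, dot_sub_comm]

lemma dot_qr (h : SameTetra p q r s p' q' r' s') :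
    dot (q - p) (r - p) = dot (q' - p') (r' - p') := by
  rw [dot_sub_sub_eq p q r, dot_sub_sub_eq p' q' r', h.pq, h.pr, h.qr]

lemma dot_qs (h : SameTetra p q r s p' q' r' s') :
    dot (q - p) (s - p) = dot (q' - p') (s' - p') := by
  rw [dot_sub_sub_eq p q s, dot_sub_sub_eq p' q' s', h.pq, h.ps, h.qs]

/-- Only the three fixed vertices must span a plane: the oriented volume places the fourth one, so
planar quads are allowed. -/
lemma eq_of_eq (h : SameTetra p q r s p' q' r' s') (hp : p = p') (hq : q = q') (hs : s = s')
    (hg : gram2 (q - p) (s - p) ≠ 0) : r = r' := by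
  subst hp hq hs
  have : r - p = r' - p := by
    refine eq_of_dot_eq_of_det3_eq hg ?_ ?_ ?_
    · rw [dot_comm, h.dot_qr, dot_comm]
    · rw [dot_comm, h.reverse.dot_qr, dot_comm]
    · have e : ∀ a b c : E3, det3 a b c = - det3 a c b := by
        intro a b c; simp only [det3]; ring
      rw [e, h.orient, ← e]
  exact sub_left_injective this

lemma symm (h : SameTetra p q r s p' q' r' s') : SameTetra p' q' r' s' p q r s :=
  ⟨h.pq.symm, h.pr.symm, h.ps.symm, h.qr.symm, h.qs.symm, h.rs.symm, h.orient.symm⟩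

lemma trans {p'' q'' r'' s'' : E3} (h : SameTetra p q r s p' q' r' s')
    (h' : SameTetra p' q' r' s' p'' q'' r'' s'') : SameTetra p q r s p'' q'' r'' s'' :=
  ⟨h.pq.trans h'.pq, h.pr.trans h'.pr, h.ps.trans h'.ps, h.qr.trans h'.qr, h.qs.trans h'.qs,
    h.rs.trans h'.rs, h.orient.trans h'.orient⟩

end SameTetra

lemma IsRotation.sameTetra {T : E3 → E3} (hT : IsRotation T) {p q r s p' q' r' s' : E3} (o o' : E3)
    (h : SameTetra p q r s p' q' r' s') :
    SameTetra (o' + T (p - o)) (o' + T (q - o)) (o' + T (r - o)) (o' + T (s - o)) p' q' r' s' := by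
  have e : ∀ x y, (o' + T (x - o)) - (o' + T (y - o)) = T (x - y) := by
    intro x y
    rw [add_sub_add_left_eq_sub, ← hT.map_sub, sub_sub_sub_cancel_right]
  constructor <;> simp only [e, hT.map_dot, hT.map_det3]
  exacts [h.pq, h.pr, h.ps, h.qr, h.qs, h.rs, h.orient]

/-- If two properly congruent tetrahedra are joined along the edge `c c₁`, the position of one of
them relative to the other is determined by the distance of two vertices. -/
lemma hinge {c c₁ a a₁ b b₁ c' c₁' a' a₁' b' b₁' : E3}
    (ha : SameTetra c c₁ a₁ a c' c₁' a₁' a') (hb : SameTetra c c₁ b₁ b c' c₁' b₁' b')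
    (hab : dot (a - c) (b - c) = dot (a' - c') (b' - c'))
    (hd : 0 < det3 (a - c) (c₁ - c) (b - c) * det3 (a' - c') (c₁' - c') (b' - c')) :
    dot (a₁ - c₁) (b₁ - c₁) = dot (a₁' - c₁') (b₁' - c₁') := by
  have g1 : gram2 (a - c) (c₁ - c) ≠ 0 := gram2_ne_zero (left_ne_zero_of_mul hd.ne')
  have g1' : gram2 (c₁' - c') (a' - c') ≠ 0 := by
    rw [gram2_comm]; exact gram2_ne_zero (right_ne_zero_of_mul hd.ne')
  have g2' : gram2 (c₁' - c') (b' - c') ≠ 0 := by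
    apply gram2_ne_zero (c := a' - c')
    have e : ∀ x y z : E3, det3 y z x = det3 x y z := by
      intro x y z; simp only [det3]; ring
    rw [e]; exact right_ne_zero_of_mul hd.ne'
  obtain ⟨T, hT, hTa, hTc⟩ := exists_isRotation ha.reverse.dot_qq ha.dot_qq
    (by rw [dot_comm, ha.dot_qs, dot_comm]) g1
  -- The rotation was chosen to match `a` and the hinge edge; `b` follows by trilateration over
  -- these two, with `hd` excluding the mirror image.
  have hTb : T (b - c) = b' - c' := by
    apply eq_of_dot_eq_of_det3_pos (u := a' - c') (v := c₁' - c')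
    · rw [← hTa, hT.map_dot, hTa, dot_comm, hab, dot_comm]
    · rw [← hTc, hT.map_dot, hTc]; exact hb.reverse.dot_qs
    · rw [hT.map_dot]; exact hb.reverse.dot_qq
    · rw [← hTa, ← hTc, hT.map_det3, hTa, hTc]; exact hd
  have hT0 : T (c - c) = 0 := by rw [hT.map_sub, sub_self]
  have e1 : c' + T (c - c) = c' := by rw [hT0, add_zero]
  have e2 : c' + T (c₁ - c) = c₁' := by rw [hTc, add_sub_cancel]
  have ha1 : c' + T (a₁ - c) = a₁' := by
    refine (hT.sameTetra c c' ha).eq_of_eq e1 e2 (by rw [hTa, add_sub_cancel]) ?_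
    rw [hTa, e1, e2, add_sub_cancel]; exact g1'
  have hb1 : c' + T (b₁ - c) = b₁' := by
    refine (hT.sameTetra c c' hb).eq_of_eq e1 e2 (by rw [hTb, add_sub_cancel]) ?_
    rw [hTb, e1, e2, add_sub_cancel]; exact g2'
  rw [← ha1, ← hb1]
  conv_rhs => rw [← e2]
  rw [add_sub_add_left_eq_sub, add_sub_add_left_eq_sub, ← hT.map_sub, ← hT.map_sub, hT.map_dot,
    sub_sub_sub_cancel_right, sub_sub_sub_cancel_right]

lemma SameLink.eq_of_eq {a b c d a' b' c' d' : E3} (h : SameLink a b c d a' b' c' d')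
    (ha : a = a') (hc : c = c') : b = b' := by
  subst ha hc
  refine eq_of_dot_eq_of_det3_pos (u := a) (v := c) ?_ h.bc h.bb ?_
  · rw [dot_comm, h.ab, dot_comm]
  · have e : ∀ x y z w : E3, det3 x y z * det3 x y w = det3 x z y * det3 x w y := by
      intro x y z w; simp only [det3]; ring
    rw [e]; exact h.abc

lemma SameLink.trans {a b c d a' b' c' d' a'' b'' c'' d'' : E3}
    (h : SameLink a b c d a' b' c' d') (h' : SameLink a' b' c' d' a'' b'' c'' d'') :
    SameLink a b c d a'' b'' c'' d'' := by
  have key : ∀ {x y z : ℝ}, 0 < x * y → 0 < y * z → 0 < x * z := by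
    intro x y z h1 h2
    have h3 := mul_pos h1 h2
    have h4 : y ≠ 0 := right_ne_zero_of_mul h1.ne'
    have h5 : 0 < y * y := mul_self_pos.2 h4
    have h6 : 0 < (x * z) * (y * y) := by linarith [show x * y * (y * z) = x * z * (y * y) by ring]
    exact pos_of_mul_pos_left h6 h5.le
  exact ⟨h.aa.trans h'.aa, h.bb.trans h'.bb, h.cc.trans h'.cc, h.dd.trans h'.dd, h.ab.trans h'.ab,
    h.bc.trans h'.bc, h.cd.trans h'.cd, h.da.trans h'.da, key h.abc h'.abc, key h.bcd h'.bcd,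
    key h.cda h'.cda, key h.dab h'.dab⟩

lemma SameLink.symm {a b c d a' b' c' d' : E3} (h : SameLink a b c d a' b' c' d') :
    SameLink a' b' c' d' a b c d :=
  ⟨h.aa.symm, h.bb.symm, h.cc.symm, h.dd.symm, h.ab.symm, h.bc.symm, h.cd.symm, h.da.symm,
    by rw [mul_comm]; exact h.abc, by rw [mul_comm]; exact h.bcd, by rw [mul_comm]; exact h.cda,
    by rw [mul_comm]; exact h.dab⟩

/-! ### Propagation of one angle through the grid -/

/-- Positions of the vertices of an infinite grid of quads. -/
abbrev Conf : Type := ℕ → ℕ → E3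

/-- The quads in position `(i, j)` are properly congruent. -/
def QuadCompat (g g' : Conf) (i j : ℕ) : Prop :=
  SameTetra (g i j) (g (i + 1) j) (g (i + 1) (j + 1)) (g i (j + 1))
    (g' i j) (g' (i + 1) j) (g' (i + 1) (j + 1)) (g' i (j + 1))

/-- The stars of the vertex `(i + 1, j + 1)` have the same angles between consecutive edges. -/
def StarCompat (g g' : Conf) (i j : ℕ) : Prop :=
  SameLink (g (i + 2) (j + 1) - g (i + 1) (j + 1)) (g (i + 1) (j + 2) - g (i + 1) (j + 1))
    (g i (j + 1) - g (i + 1) (j + 1)) (g (i + 1) j - g (i + 1) (j + 1))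
    (g' (i + 2) (j + 1) - g' (i + 1) (j + 1)) (g' (i + 1) (j + 2) - g' (i + 1) (j + 1))
    (g' i (j + 1) - g' (i + 1) (j + 1)) (g' (i + 1) j - g' (i + 1) (j + 1))

/-- The dot product of the two edges in the first direction at `(i + 1, j + 1)`. -/
def rowDot (g : Conf) (i j : ℕ) : ℝ :=
  dot (g (i + 2) (j + 1) - g (i + 1) (j + 1)) (g i (j + 1) - g (i + 1) (j + 1))

/-- The dot product of the two edges in the second direction at `(i + 1, j + 1)`. -/
def colDot (g : Conf) (i j : ℕ) : ℝ :=
  dot (g (i + 1) (j + 2) - g (i + 1) (j + 1)) (g (i + 1) j - g (i + 1) (j + 1))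

/-- All quads and stars of the `m × n` part of the grid agree. -/
structure Compat (m n : ℕ) (g g' : Conf) : Prop where
  quad : ∀ i j, i < m → j < n → QuadCompat g g' i j
  star : ∀ i j, i + 2 ≤ m → j + 2 ≤ n → StarCompat g g' i j

/-- All stars and all quads agree, except possibly those of the last row if there are at least
three rows. -/
structure SkelCompat (m n : ℕ) (g g' : Conf) : Prop where
  quad : ∀ i j, i < 2 ∨ i + 1 < m → j < n → QuadCompat g g' i j
  star : ∀ i j, i + 2 ≤ m → j + 2 ≤ n → StarCompat g g' i j

lemma Compat.skel {m n : ℕ} {g g' : Conf} (h : Compat m n g g') (hm : 2 ≤ m) :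
    SkelCompat m n g g' :=
  ⟨fun i j hi hj => h.quad i j (by omega) hj, h.star⟩

lemma Compat.symm {m n : ℕ} {g g' : Conf} (h : Compat m n g g') : Compat m n g' g :=
  ⟨fun i j hi hj => (h.quad i j hi hj).symm, fun i j hi hj => (h.star i j hi hj).symm⟩

lemma Compat.trans {m n : ℕ} {g g' g'' : Conf} (h : Compat m n g g') (h' : Compat m n g' g'') :
    Compat m n g g'' :=
  ⟨fun i j hi hj => (h.quad i j hi hj).trans (h'.quad i j hi hj),
    fun i j hi hj => (h.star i j hi hj).trans (h'.star i j hi hj)⟩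

lemma SkelCompat.trans {m n : ℕ} {g g' g'' : Conf} (h : SkelCompat m n g g')
    (h' : SkelCompat m n g' g'') : SkelCompat m n g g'' :=
  ⟨fun i j hi hj => (h.quad i j hi hj).trans (h'.quad i j hi hj),
    fun i j hi hj => (h.star i j hi hj).trans (h'.star i j hi hj)⟩

lemma StarCompat.rowDot_eq_iff {g g' : Conf} {i j : ℕ} (h : StarCompat g g' i j) :
    rowDot g i j = rowDot g' i j ↔ colDot g i j = colDot g' i j :=
  h.dot_eq_iff

section Propagation

variable {m n : ℕ} {g g' : Conf}

/-- The hinge is the edge from `(i + 1, j + 1)` to `(i + 1, j + 2)`, shared by the quads `(i, j +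
1)` and `(i + 1, j + 1)`. -/
lemma Compat.rowDot_succ_col (h : Compat m n g g') {i j : ℕ} (hi : i + 2 ≤ m) (hj : j + 3 ≤ n) :
    rowDot g i j = rowDot g' i j ↔ rowDot g i (j + 1) = rowDot g' i (j + 1) := by
  have q1 := h.quad (i + 1) (j + 1) (by omega) (by omega)
  have q0 := h.quad i (j + 1) (by omega) (by omega)
  have s0 := h.star i j (by omega) (by omega)
  have s1 := h.star i (j + 1) (by omega) (by omega)
  refine ⟨fun e => hinge q1.reverse q0.rotate e s0.abc, fun e =>
    hinge q1.reverse.rotate.reverse q0.rotate.rotate.reverse e ?_⟩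
  have e' : ∀ x y z x' y' z' : E3, det3 x y z * det3 x' y' z' = det3 z y x * det3 z' y' x' := by
      intro x y z x' y' z'; simp only [det3]; ring
  rw [e']
  exact s1.cda

lemma Compat.colDot_succ_row (h : Compat m n g g') {i j : ℕ} (hi : i + 3 ≤ m) (hj : j + 2 ≤ n) :
    colDot g i j = colDot g' i j ↔ colDot g (i + 1) j = colDot g' (i + 1) j := by
  have q1 := h.quad (i + 1) (j + 1) (by omega) (by omega)
  have q0 := h.quad (i + 1) j (by omega) (by omega)
  have s0 := h.star i j (by omega) (by omega)
  have s1 := h.star (i + 1) j (by omega) (by omega)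
  have e' : ∀ x y z x' y' z' : E3, det3 x y z * det3 x' y' z' = det3 z y x * det3 z' y' x' := by
      intro x y z x' y' z'; simp only [det3]; ring
  refine ⟨fun e => hinge q1 q0.rotate.rotate.rotate.reverse e ?_, fun e =>
    hinge q1.rotate.reverse q0.rotate.rotate e s1.bcd⟩
  rw [e']
  exact s0.dab

/-- Hinges carry `rowDot` along the second index. Along the first index they carry only `colDot`, so
there the star at each vertex is used to exchange `rowDot` for `colDot` and back. -/
lemma Compat.rowDot_iff (h : Compat m n g g') {i j : ℕ} (hi : i + 2 ≤ m) (hj : j + 2 ≤ n) :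
    rowDot g 0 0 = rowDot g' 0 0 ↔ rowDot g i j = rowDot g' i j := by
  have h1 : ∀ j, j + 2 ≤ n → (rowDot g 0 0 = rowDot g' 0 0 ↔ rowDot g 0 j = rowDot g' 0 j) := by
    intro j
    induction j with
    | zero => intro _; rfl
    | succ j ih => intro hj; rw [ih (by omega)]; exact h.rowDot_succ_col (by omega) hj
  rw [h1 j hj]
  clear h1
  induction i with
  | zero => rfl
  | succ i ih =>
    refine (ih (by omega)).trans ?_
    rw [(h.star i j (by omega) hj).rowDot_eq_iff, h.colDot_succ_row hi hj,
      (h.star (i + 1) j (by omega) hj).rowDot_eq_iff]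

lemma SameLink.gram2_ne {a b c d a' b' c' d' : E3} (h : SameLink a b c d a' b' c' d') :
    gram2 a b ≠ 0 :=
  gram2_ne_zero (left_ne_zero_of_mul h.abc.ne')

/-- Three vertices and one angle determine all the others: stars give the next inner vertex by
trilateration, quads give the border vertices. For `m ≥ 3` the corners `(m, 0)` and `(m, n)` are
left out, since only quads of the last row would fix them. -/
lemma SkelCompat.eq_of_eq (h : SkelCompat m n g g') (hm : 2 ≤ m) (hn : 2 ≤ n)
    (h11 : g 1 1 = g' 1 1) (h21 : g 2 1 = g' 2 1) (h10 : g 1 0 = g' 1 0)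
    (hx : rowDot g 0 0 = rowDot g' 0 0) :
    ∀ i j, i ≤ m → j ≤ n → (i < m ∨ i ≤ 2 ∨ 0 < j ∧ j < n) → g i j = g' i j := by
  have s0 := h.star 0 0 hm hn
  have h01 : g 0 1 = g' 0 1 := by
    unfold rowDot at hx
    have : g 0 1 - g 1 1 = g' 0 1 - g' 1 1 := by
      refine eq_of_dot_eq_of_det3_pos (u := g 1 0 - g 1 1) (v := g 2 1 - g 1 1) ?_ ?_ s0.cc ?_
      · have := s0.cd; simp only [zero_add] at this; rw [this, h11, h10]
      · rw [dot_comm]; simp only [zero_add] at hx; rw [hx, dot_comm, h11, h21]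
      · have e : ∀ x y z x' y' z' : E3, det3 x y z * det3 x' y' z' = det3 z x y * det3 z' x' y' := by
          intro x y z x' y' z'; simp only [det3]; ring
        have := s0.cda
        simp only [zero_add] at this
        rw [e]
        conv at this => enter [2, 2]; rw [← h11, ← h21, ← h10]
        rw [h11] at this ⊢; exact this
    rw [h11] at this
    exact sub_left_injective this
  have cols : ∀ k, k + 1 ≤ n → ∀ i j, i ≤ 2 → j ≤ k + 1 → g i j = g' i j := by
    intro k
    induction k with
    | zero =>
      intro _
      have h20 : g 2 0 = g' 2 0 :=
        (h.quad 1 0 (by omega) (by omega)).rotate.rotate.rotate.eq_of_eq h11 h10 h21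
          s0.rotate.rotate.rotate.gram2_ne
      have h00 : g 0 0 = g' 0 0 :=
        (h.quad 0 0 (by omega) (by omega)).rotate.rotate.eq_of_eq h11 h01 h10
          s0.rotate.rotate.gram2_ne
      intro i j hi hj
      interval_cases i <;> interval_cases j <;> assumption
    | succ k ih =>
      intro hk
      have ih := ih (by omega)
      have s := h.star 0 k hm (by omega)
      have e1 : g 1 (k + 2) = g' 1 (k + 2) := by
        have c := ih 1 (k + 1) (by omega) le_rfl
        have := s.eq_of_eq (congrArg₂ _ (ih 2 _ (by omega) le_rfl) c)
          (congrArg₂ _ (ih 0 _ (by omega) le_rfl) c)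
        simp only [zero_add, c] at this
        exact sub_left_injective this
      have e2 : g 2 (k + 2) = g' 2 (k + 2) :=
        (h.quad 1 (k + 1) (by omega) (by omega)).eq_of_eq
          (ih _ _ (by omega) (by omega)) (ih _ _ (by omega) (by omega)) e1 s.gram2_ne
      have e0 : g 0 (k + 2) = g' 0 (k + 2) :=
        (h.quad 0 (k + 1) (by omega) (by omega)).rotate.eq_of_eq
          (ih _ _ (by omega) (by omega)) e1 (ih _ _ (by omega) (by omega)) s.rotate.gram2_ne
      intro i j hi hj
      rcases (by omega : j ≤ k + 1 ∨ j = k + 2) with hj | rfl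
      · exact ih i j hi hj
      · interval_cases i <;> assumption
  have rows : ∀ k, k + 2 ≤ m → ∀ i j, i ≤ k + 2 → j ≤ n →
      (i < m ∨ i ≤ 2 ∨ 0 < j ∧ j < n) → g i j = g' i j := by
    intro k
    induction k with
    | zero => intro _ i j hi hj _; exact cols (n - 1) (by omega) i j hi (by omega)
    | succ k ih =>
      intro hk
      have ih := ih (by omega)
      have e1 : ∀ j, j + 2 ≤ n → g (k + 3) (j + 1) = g' (k + 3) (j + 1) := by
        intro j hj
        have s := h.star (k + 1) j (by omega) (by omega)
        have c := ih (k + 2) (j + 1) le_rfl (by omega) (by omega)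
        have := s.rotate.rotate.rotate.eq_of_eq
          (congrArg₂ _ (ih _ _ le_rfl (by omega) (by omega)) c)
          (congrArg₂ _ (ih _ _ le_rfl (by omega) (by omega)) c)
        simp only [c] at this
        exact sub_left_injective this
      have e0 : k + 3 < m → g (k + 3) 0 = g' (k + 3) 0 := fun hk' =>
        (h.quad (k + 2) 0 (by omega) (by omega)).rotate.rotate.rotate.eq_of_eq
          (ih _ _ (by omega) (by omega) (by omega)) (ih _ _ (by omega) (by omega) (by omega))
          (e1 0 (by omega)) (h.star (k + 1) 0 (by omega) (by omega)).rotate.rotate.rotate.gram2_ne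
      have e2 : k + 3 < m → g (k + 3) n = g' (k + 3) n := by
        intro hk'
        obtain ⟨l, rfl⟩ : ∃ l, n = l + 2 := ⟨n - 2, by omega⟩
        exact (h.quad (k + 2) (l + 1) (by omega) (by omega)).eq_of_eq
          (ih _ _ (by omega) (by omega) (by omega)) (e1 l (by omega))
          (ih _ _ (by omega) (by omega) (by omega))
          (h.star (k + 1) l (by omega) (by omega)).gram2_ne
      intro i j hi hj hij
      rcases (by omega : i ≤ k + 2 ∨ i = k + 3) with hi | rfl
      · exact ih i j hi hj hij
      · rcases (by omega : j = 0 ∨ j = n ∨ 0 < j ∧ j < n) with rfl | rfl | ⟨h0, hl⟩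
        · exact e0 (by omega)
        · exact e2 (by omega)
        · obtain ⟨l, rfl⟩ := Nat.exists_eq_succ_of_ne_zero h0.ne'
          exact e1 l hl
  intro i j hi hj
  exact rows (m - 2) (by omega) i j (by omega) hj

lemma IsRotation.apply_sub {T : E3 → E3} (hT : IsRotation T) (o o' x y : E3) :
    (o' + T (x - o)) - (o' + T (y - o)) = T (x - y) := by
  rw [add_sub_add_left_eq_sub, ← hT.map_sub, sub_sub_sub_cancel_right]

lemma IsRotation.skelCompat {T : E3 → E3} (hT : IsRotation T) (o o' : E3)
    (h : SkelCompat m n g g') : SkelCompat m n (fun i j => o' + T (g i j - o)) g' := by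
  refine ⟨fun i j hi hj => hT.sameTetra o o' (h.quad i j hi hj), fun i j hi hj => ?_⟩
  have s := h.star i j hi hj
  constructor <;> simp only [hT.apply_sub, hT.map_dot, hT.map_det3]
  exacts [s.aa, s.bb, s.cc, s.dd, s.ab, s.bc, s.cd, s.da, s.abc, s.bcd, s.cda, s.dab]

theorem SkelCompat.exists_isRotation (h : SkelCompat m n g g') (hm : 2 ≤ m) (hn : 2 ≤ n)
    (hx : rowDot g 0 0 = rowDot g' 0 0) :
    ∃ T o o', IsRotation T ∧ ∀ i j, i ≤ m → j ≤ n → (i < m ∨ i ≤ 2 ∨ 0 < j ∧ j < n) →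
      o' + T (g i j - o) = g' i j := by
  have s := h.star 0 0 hm hn
  obtain ⟨T, hT, h1, h2⟩ := SkewQuad.exists_isRotation s.dd s.aa s.da s.rotate.rotate.rotate.gram2_ne
  refine ⟨T, g 1 1, g' 1 1, hT, ?_⟩
  have hT0 : T (g 1 1 - g 1 1) = 0 := by rw [hT.map_sub, sub_self]
  refine (hT.skelCompat (g 1 1) (g' 1 1) h).eq_of_eq hm hn ?_ ?_ ?_ ?_
  · simp only [hT0, add_zero]
  · simp only [zero_add] at h2; simp only [h2, add_sub_cancel]
  · simp only [zero_add] at h1; simp only [h1, add_sub_cancel]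
  · rw [← hx]
    simp only [rowDot, hT.apply_sub, hT.map_dot]

theorem SkelCompat.dot_eq (h : SkelCompat m n g g') (hm : 2 ≤ m) (hn : 2 ≤ n)
    (hx : rowDot g 0 0 = rowDot g' 0 0) {i j k l : ℕ} (hi : i ≤ m) (hj : j ≤ n)
    (hij : i < m ∨ i ≤ 2 ∨ 0 < j ∧ j < n) (hk : k ≤ m) (hl : l ≤ n)
    (hkl : k < m ∨ k ≤ 2 ∨ 0 < l ∧ l < n) :
    dot (g i j - g k l) (g i j - g k l) = dot (g' i j - g' k l) (g' i j - g' k l) := by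
  obtain ⟨T, o, o', hT, e⟩ := h.exists_isRotation hm hn hx
  rw [← e i j hi hj hij, ← e k l hk hl hkl, hT.apply_sub, hT.map_dot]

theorem Compat.exists_isRotation (h : Compat m n g g') (hm : 2 ≤ m) (hn : 2 ≤ n)
    (hx : rowDot g 0 0 = rowDot g' 0 0) :
    ∃ T o o', IsRotation T ∧ ∀ i j, i ≤ m → j ≤ n → o' + T (g i j - o) = g' i j := by
  obtain ⟨T, o, o', hT, e⟩ := (h.skel hm).exists_isRotation hm hn hx
  refine ⟨T, o, o', hT, ?_⟩
  obtain ⟨k, rfl⟩ : ∃ k, m = k + 2 := ⟨m - 2, by omega⟩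
  obtain ⟨l, rfl⟩ : ∃ l, n = l + 2 := ⟨n - 2, by omega⟩
  intro i j hi hj
  rcases (by omega : (i < k + 2 ∨ i ≤ 2 ∨ 0 < j ∧ j < l + 2) ∨ i = k + 2 ∧ j = 0 ∨
    i = k + 2 ∧ j = l + 2) with hij | ⟨rfl, rfl⟩ | ⟨rfl, rfl⟩
  · exact e i j hi hj hij
  -- The two corners missing from the skeleton are fourth vertices of quads of the last row.
  · exact (hT.sameTetra o o' (h.quad (k + 1) 0 (by omega) (by omega))).rotate.rotate.rotate.eq_of_eq
      (e _ _ (by omega) (by omega) (by omega)) (e _ _ (by omega) (by omega) (by omega))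
      (e _ _ (by omega) (by omega) (by omega))
      ((hT.skelCompat o o' (h.skel hm)).star k 0 (by omega) (by omega)).rotate.rotate.rotate.gram2_ne
  · exact (hT.sameTetra o o' (h.quad (k + 1) (l + 1) (by omega) (by omega))).eq_of_eq
      (e _ _ (by omega) (by omega) (by omega)) (e _ _ (by omega) (by omega) (by omega))
      (e _ _ (by omega) (by omega) (by omega))
      ((hT.skelCompat o o' (h.skel hm)).star k l (by omega) (by omega)).gram2_ne

end Propagation

/-! ### Orientations along a motion, and nontrivial motions -/

/-- Two quadruples of points with the same distances. -/
structure SameDist (p q r s p' q' r' s' : E3) : Prop where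
  pq : dot (p - q) (p - q) = dot (p' - q') (p' - q')
  pr : dot (p - r) (p - r) = dot (p' - r') (p' - r')
  ps : dot (p - s) (p - s) = dot (p' - s') (p' - s')
  qr : dot (q - r) (q - r) = dot (q' - r') (q' - r')
  qs : dot (q - s) (q - s) = dot (q' - s') (q' - s')
  rs : dot (r - s) (r - s) = dot (r' - s') (r' - s')

lemma SameDist.sameTetra {p q r s p' q' r' s' : E3} (h : SameDist p q r s p' q' r' s')
    (ho : det3 (q - p) (r - p) (s - p) = det3 (q' - p') (r' - p') (s' - p')) :
    SameTetra p q r s p' q' r' s' :=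
  ⟨h.pq, h.pr, h.ps, h.qr, h.qs, h.rs, ho⟩

lemma det3_sq_eq_of_dot_eq {a b c a' b' c' : E3} (haa : dot a a = dot a' a')
    (hbb : dot b b = dot b' b') (hcc : dot c c = dot c' c') (hab : dot a b = dot a' b')
    (hac : dot a c = dot a' c') (hbc : dot b c = dot b' c') :
    det3 a b c ^ 2 = det3 a' b' c' ^ 2 := by
  rw [sq, sq, det3_mul_det3, det3_mul_det3, dot_comm b a, dot_comm c a, dot_comm c b,
    dot_comm b' a', dot_comm c' a', dot_comm c' b', haa, hbb, hcc, hab, hac, hbc]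

lemma SameDist.det3_sq {p q r s p' q' r' s' : E3} (h : SameDist p q r s p' q' r' s') :
    det3 (q - p) (r - p) (s - p) ^ 2 = det3 (q' - p') (r' - p') (s' - p') ^ 2 := by
  apply det3_sq_eq_of_dot_eq
  · rw [dot_sub_comm, h.pq, dot_sub_comm]
  · rw [dot_sub_comm, h.pr, dot_sub_comm]
  · rw [dot_sub_comm, h.ps, dot_sub_comm]
  · rw [dot_sub_sub_eq, dot_sub_sub_eq p' q' r', h.pq, h.pr, h.qr]
  · rw [dot_sub_sub_eq, dot_sub_sub_eq p' q' s', h.pq, h.ps, h.qs]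
  · rw [dot_sub_sub_eq, dot_sub_sub_eq p' r' s', h.pr, h.ps, h.rs]

/-- The quads in position `(i, j)` have the same distances. -/
def QuadDist (g g' : Conf) (i j : ℕ) : Prop :=
  SameDist (g i j) (g (i + 1) j) (g (i + 1) (j + 1)) (g i (j + 1))
    (g' i j) (g' (i + 1) j) (g' (i + 1) (j + 1)) (g' i (j + 1))

/-- The oriented volume of the quad in position `(i, j)`. -/
def quadDet (g : Conf) (i j : ℕ) : ℝ :=
  det3 (g (i + 1) j - g i j) (g (i + 1) (j + 1) - g i j) (g i (j + 1) - g i j)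

/-- The four edges at `(i + 1, j + 1)` in cyclic order. -/
def starEdge (g : Conf) (i j : ℕ) : Fin 4 → E3 :=
  ![g (i + 2) (j + 1) - g (i + 1) (j + 1), g (i + 1) (j + 2) - g (i + 1) (j + 1),
    g i (j + 1) - g (i + 1) (j + 1), g (i + 1) j - g (i + 1) (j + 1)]

/-- The determinant of three consecutive edges at `(i + 1, j + 1)`. -/
def starDet (g : Conf) (i j : ℕ) (k : Fin 4) : ℝ :=
  det3 (starEdge g i j k) (starEdge g i j (k + 1)) (starEdge g i j (k + 2))

lemma QuadDist.quadCompat {g g' : Conf} {i j : ℕ} (h : QuadDist g g' i j)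
    (hd : quadDet g i j = quadDet g' i j) : QuadCompat g g' i j :=
  SameDist.sameTetra h hd

lemma starCompat_of_dot_eq {g g' : Conf} {i j : ℕ}
    (h : ∀ k, dot (starEdge g i j k) (starEdge g i j k)
      = dot (starEdge g' i j k) (starEdge g' i j k))
    (h' : ∀ k, dot (starEdge g i j k) (starEdge g i j (k + 1))
      = dot (starEdge g' i j k) (starEdge g' i j (k + 1)))
    (hd : ∀ k, 0 < starDet g i j k * starDet g' i j k) : StarCompat g g' i j :=
  ⟨h 0, h 1, h 2, h 3, h' 0, h' 1, h' 2, h' 3, hd 0, hd 1, hd 2, hd 3⟩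

lemma starCompat_of_quadDist {g g' : Conf} {i j : ℕ} (h00 : QuadDist g g' i j)
    (h10 : QuadDist g g' (i + 1) j) (h01 : QuadDist g g' i (j + 1))
    (h11 : QuadDist g g' (i + 1) (j + 1))
    (hd : ∀ k, 0 < starDet g i j k * starDet g' i j k) : StarCompat g g' i j := by
  have e0 : dot (g (i + 1) (j + 1) - g (i + 2) (j + 1)) (g (i + 1) (j + 1) - g (i + 2) (j + 1)) =
    dot (g' (i + 1) (j + 1) - g' (i + 2) (j + 1)) (g' (i + 1) (j + 1) - g' (i + 2) (j + 1)) := h11.pq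
  have e1 : dot (g (i + 1) (j + 1) - g (i + 1) (j + 2)) (g (i + 1) (j + 1) - g (i + 1) (j + 2)) =
    dot (g' (i + 1) (j + 1) - g' (i + 1) (j + 2)) (g' (i + 1) (j + 1) - g' (i + 1) (j + 2)) := h11.ps
  have e2 : dot (g (i + 1) (j + 1) - g i (j + 1)) (g (i + 1) (j + 1) - g i (j + 1)) =
    dot (g' (i + 1) (j + 1) - g' i (j + 1)) (g' (i + 1) (j + 1) - g' i (j + 1)) := h00.rs
  have e3 : dot (g (i + 1) (j + 1) - g (i + 1) j) (g (i + 1) (j + 1) - g (i + 1) j) =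
      dot (g' (i + 1) (j + 1) - g' (i + 1) j) (g' (i + 1) (j + 1) - g' (i + 1) j) := by
    rw [dot_sub_comm, h00.qr, dot_sub_comm]
  have d0 : dot (g (i + 2) (j + 1) - g (i + 1) (j + 2)) (g (i + 2) (j + 1) - g (i + 1) (j + 2)) =
    dot (g' (i + 2) (j + 1) - g' (i + 1) (j + 2)) (g' (i + 2) (j + 1) - g' (i + 1) (j + 2)) := h11.qs
  have d1 : dot (g (i + 1) (j + 2) - g i (j + 1)) (g (i + 1) (j + 2) - g i (j + 1)) =
      dot (g' (i + 1) (j + 2) - g' i (j + 1)) (g' (i + 1) (j + 2) - g' i (j + 1)) := by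
    rw [dot_sub_comm, h01.pr, dot_sub_comm]
  have d2 : dot (g i (j + 1) - g (i + 1) j) (g i (j + 1) - g (i + 1) j) =
      dot (g' i (j + 1) - g' (i + 1) j) (g' i (j + 1) - g' (i + 1) j) := by
    rw [dot_sub_comm, h00.qs, dot_sub_comm]
  have d3 : dot (g (i + 1) j - g (i + 2) (j + 1)) (g (i + 1) j - g (i + 2) (j + 1)) =
      dot (g' (i + 1) j - g' (i + 2) (j + 1)) (g' (i + 1) j - g' (i + 2) (j + 1)) := h10.pr
  apply starCompat_of_dot_eq _ _ hd
  · intro k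
    fin_cases k
    · exact (dot_sub_comm _ _).trans (e0.trans (dot_sub_comm _ _))
    · exact (dot_sub_comm _ _).trans (e1.trans (dot_sub_comm _ _))
    · exact (dot_sub_comm _ _).trans (e2.trans (dot_sub_comm _ _))
    · exact (dot_sub_comm _ _).trans (e3.trans (dot_sub_comm _ _))
  · have key : ∀ p q r p' q' r' : E3, dot (p - q) (p - q) = dot (p' - q') (p' - q') →
        dot (p - r) (p - r) = dot (p' - r') (p' - r') →
        dot (q - r) (q - r) = dot (q' - r') (q' - r') →
        dot (q - p) (r - p) = dot (q' - p') (r' - p') := by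
      intro p q r p' q' r' h1 h2 h3
      rw [dot_sub_sub_eq p q r, dot_sub_sub_eq p' q' r', h1, h2, h3]
    intro k
    fin_cases k
    · exact key _ _ _ _ _ _ e0 e1 d0
    · exact key _ _ _ _ _ _ e1 e2 d1
    · exact key _ _ _ _ _ _ e2 e3 d2
    · exact key _ _ _ _ _ _ e3 e0 d3

/-- The extension of a surface to the infinite grid by its boundary values. -/
def toConf {m n : ℕ} (f : QuadSurface m n) : Conf :=
  fun i j => f (⟨min i m, by omega⟩, ⟨min j n, by omega⟩)

section

variable {m n : ℕ} {f : QuadSurface m n}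

lemma toConf_eq {i j : ℕ} (hi : i ≤ m) (hj : j ≤ n) :
    toConf f i j = f (⟨i, by omega⟩, ⟨j, by omega⟩) := by
  simp only [toConf, min_eq_left hi, min_eq_left hj]

lemma toConf_val (p : Fin (m + 1) × Fin (n + 1)) : toConf f p.1 p.2 = f p :=
  toConf_eq (by omega) (by omega)

lemma det3_ne_zero_of_linearIndependent {v : Fin 3 → E3} (h : LinearIndependent ℝ v) :
    det3 (v 0) (v 1) (v 2) ≠ 0 := by
  let A : Matrix (Fin 3) (Fin 3) ℝ := fun i j => v i j
  have hA : det3 (v 0) (v 1) (v 2) = A.det := by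
    rw [Matrix.det_fin_three]
    simp only [det3, A]; ring
  rw [hA]
  intro h0
  obtain ⟨w, hw, hw'⟩ := Matrix.exists_vecMul_eq_zero_iff.2 h0
  apply hw
  have := Fintype.linearIndependent_iff.1 h w ?_
  · exact funext this
  · ext j
    have := congrFun hw' j
    simpa [Matrix.vecMul, dotProduct, A, Fin.sum_univ_three] using this

lemma _root_.NonDegenerate.starDet_ne_zero (hf : NonDegenerate f) {i j : ℕ} (hi : i + 2 ≤ m)
    (hj : j + 2 ≤ n) (k : Fin 4) : starDet (toConf f) i j k ≠ 0 := by
  have e : ∀ k, starEdge (toConf f) i j k = edgeStar f i j hi hj k := by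
    have h1 : i + 1 ≤ m := by omega
    have h2 : j + 1 ≤ n := by omega
    have h3 : i ≤ m := by omega
    have h4 : j ≤ n := by omega
    intro k
    fin_cases k <;> simp [starEdge, edgeStar, toConf_eq, hi, hj, h1, h2, h3, h4]
  have e1 : ∀ x y z : E3, det3 x y z = det3 z x y := by
    intro x y z; simp only [det3]; ring
  simp only [starDet, e]
  -- The consecutive triple starting at `k` omits the edge `k + 3` modulo `4`. For `k = 2` and `k =
  -- 3` the increasing enumeration by `succAbove` differs from it by a cyclic permutation.
  fin_cases k
  · exact det3_ne_zero_of_linearIndependent (hf i j hi hj 3)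
  · exact det3_ne_zero_of_linearIndependent (hf i j hi hj 0)
  · rw [e1]; exact det3_ne_zero_of_linearIndependent (hf i j hi hj 1)
  · rw [← e1]; exact det3_ne_zero_of_linearIndependent (hf i j hi hj 2)

lemma _root_.IsMotion.quadDist {F : ℝ → QuadSurface m n} (hF : IsMotion f F) {t : ℝ}
    (ht : t ∈ Icc (0 : ℝ) 1) {i j : ℕ} (hi : i < m) (hj : j < n) :
    QuadDist (toConf (F t)) (toConf f) i j := by
  have key : ∀ k l k' l', (k = i ∨ k = i + 1) → (l = j ∨ l = j + 1) → (k' = i ∨ k' = i + 1) →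
      (l' = j ∨ l' = j + 1) →
      dot (toConf (F t) k l - toConf (F t) k' l') (toConf (F t) k l - toConf (F t) k' l') =
      dot (toConf f k l - toConf f k' l') (toConf f k l - toConf f k' l') := by
    intro k l k' l' hk hl hk' hl'
    rw [← dist_eq_dist_iff, toConf_eq (by omega) (by omega), toConf_eq (by omega) (by omega),
      toConf_eq (by omega) (by omega), toConf_eq (by omega) (by omega)]
    refine hF.rigid t ht ⟨i, hi⟩ ⟨j, hj⟩ _ ?_ _ ?_ <;>
    simp [quadVertices, hk, hl, hk', hl']
  constructor <;> exact key _ _ _ _ (by simp) (by simp) (by simp) (by simp)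

lemma _root_.IsMotion.continuousOn_apply {F : ℝ → QuadSurface m n} (hF : IsMotion f F) (i j : ℕ)
    (k : Fin 3) : ContinuousOn (fun t => toConf (F t) i j k) (Icc 0 1) := by
  have h1 := continuousOn_pi.1 hF.continuousOn (⟨min i m, by omega⟩, ⟨min j n, by omega⟩)
  exact (PiLp.continuous_apply 2 (fun _ : Fin 3 => ℝ) k).comp_continuousOn h1

lemma _root_.IsMotion.continuousOn_det3 {F : ℝ → QuadSurface m n} (hF : IsMotion f F)
    (i j i' j' k l k' l' p q p' q' : ℕ) : ContinuousOn
      (fun t => det3 (toConf (F t) i j - toConf (F t) i' j') (toConf (F t) k l - toConf (F t) k' l')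
        (toConf (F t) p q - toConf (F t) p' q')) (Icc 0 1) := by
  have h := hF.continuousOn_apply
  simp only [det3, PiLp.sub_apply]
  fun_prop (disch := assumption)

/-- The square of the oriented volume is a function of the distances, hence constant; on a connected
interval a continuous nonzero volume cannot change sign. -/
lemma _root_.IsMotion.quadCompat {F : ℝ → QuadSurface m n} (hF : IsMotion f F) {t : ℝ}
    (ht : t ∈ Icc (0 : ℝ) 1) {i j : ℕ} (hi : i < m) (hj : j < n) :
    QuadCompat (toConf (F t)) (toConf f) i j := by
  apply (hF.quadDist ht hi hj).quadCompat
  have hsq : ∀ t ∈ Icc (0 : ℝ) 1, quadDet (toConf (F t)) i j ^ 2 = quadDet (toConf f) i j ^ 2 :=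
    fun t ht => (hF.quadDist ht hi hj).det3_sq
  by_cases h0 : quadDet (toConf f) i j = 0
  · have := hsq t ht
    rw [h0] at this ⊢
    simpa using this
  · refine isPreconnected_Icc.eq_of_sq_eq (hF.continuousOn_det3 _ _ _ _ _ _ _ _ _ _ _ _)
      (g := fun _ => quadDet (toConf f) i j) continuousOn_const hsq ?_
      (left_mem_Icc.2 zero_le_one) ?_ ht
    · intro _ _; exact h0
    · simp only [hF.start]; rfl

lemma _root_.IsMotion.continuousOn_rowDot {F : ℝ → QuadSurface m n} (hF : IsMotion f F)
    (i j : ℕ) : ContinuousOn (fun t => rowDot (toConf (F t)) i j) (Icc 0 1) := by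
  have h := hF.continuousOn_apply
  simp only [rowDot, dot, PiLp.sub_apply]
  fun_prop (disch := assumption)

lemma _root_.IsMotion.continuousOn_starDet {F : ℝ → QuadSurface m n} (hF : IsMotion f F)
    (i j : ℕ) (k : Fin 4) : ContinuousOn (fun t => starDet (toConf (F t)) i j k) (Icc 0 1) := by
  fin_cases k <;> exact hF.continuousOn_det3 _ _ _ _ _ _ _ _ _ _ _ _

/-- Equality of the determinants, beyond that of their signs, is what keeps the continuous induction
in `IsMotion.exists_rowDot_ne` going. -/
lemma Compat.starDet_eq {g g' : Conf} (h : Compat m n g g') (hm : 2 ≤ m) (hn : 2 ≤ n)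
    (hx : rowDot g 0 0 = rowDot g' 0 0) {i j : ℕ} (hi : i + 2 ≤ m) (hj : j + 2 ≤ n) (k : Fin 4) :
    starDet g i j k = starDet g' i j k := by
  obtain ⟨T, o, o', hT, e⟩ := h.exists_isRotation hm hn hx
  have e2 : ∀ i j k l, i ≤ m → j ≤ n → k ≤ m → l ≤ n → g' i j - g' k l = T (g i j - g k l) := by
    intro i j k l hi hj hk hl
    rw [← e i j hi hj, ← e k l hk hl, hT.apply_sub]
  have e3 : ∀ k, starEdge g' i j k = T (starEdge g i j k) := by
    intro k
    fin_cases k <;> exact e2 _ _ _ _ (by omega) (by omega) (by omega) (by omega)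
  simp only [starDet, e3, hT.map_det3]

/-- A motion that is not trivial changes the dihedral angles at every inner vertex, and passes
through surfaces which are close to the initial one up to a rigid motion. -/
theorem _root_.IsMotion.exists_rowDot_ne {F : ℝ → QuadSurface m n} (hF : IsMotion f F)
    (hf : NonDegenerate f) (hm : 2 ≤ m) (hn : 2 ≤ n)
    (hc : ∃ t ∈ Icc (0 : ℝ) 1, ¬ IsCongruent (F t) f) {i₀ j₀ : ℕ} (hi₀ : i₀ + 2 ≤ m)
    (hj₀ : j₀ + 2 ≤ n) {ε : ℝ} (hε : 0 < ε) :
    ∃ t ∈ Icc (0 : ℝ) 1, Compat m n (toConf (F t)) (toConf f) ∧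
      rowDot (toConf (F t)) i₀ j₀ ≠ rowDot (toConf f) i₀ j₀ ∧
      |rowDot (toConf (F t)) i₀ j₀ - rowDot (toConf f) i₀ j₀| < ε := by
  by_contra! hcon
  -- The orientation signs of the stars could change later in the motion. So all star determinants
  -- are tracked together with the angle, and `Φ` is shown to be constant.
  let Φ : ℝ → ℝ × (Fin (m - 1) × Fin (n - 1) × Fin 4 → ℝ) := fun t =>
    (rowDot (toConf (F t)) i₀ j₀, fun x => starDet (toConf (F t)) x.1 x.2.1 x.2.2)
  have hΦ : ContinuousOn Φ (Icc 0 1) := (hF.continuousOn_rowDot i₀ j₀).prodMk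
    (continuousOn_pi.2 fun x => hF.continuousOn_starDet x.1 x.2.1 x.2.2)
  have compat : ∀ t ∈ Icc (0 : ℝ) 1, (∀ x : Fin (m - 1) × Fin (n - 1) × Fin 4,
      0 < (Φ t).2 x * (Φ 0).2 x) → Compat m n (toConf (F t)) (toConf f) := by
    intro t ht hd
    refine ⟨fun i j hi hj => hF.quadCompat ht hi hj, fun i j hi hj => ?_⟩
    refine starCompat_of_quadDist (hF.quadDist ht (by omega) (by omega))
      (hF.quadDist ht (by omega) (by omega)) (hF.quadDist ht (by omega) (by omega))
      (hF.quadDist ht (by omega) (by omega)) fun k => ?_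
    have := hd (⟨i, by omega⟩, ⟨j, by omega⟩, k)
    simpa only [Φ, hF.start] using this
  have hne : ∀ x, (Φ 0).2 x ≠ 0 := fun x => by
    simp only [Φ, hF.start]
    exact hf.starDet_ne_zero (by omega) (by omega) _
  -- Continuous induction. Just after a time with `Φ t = Φ 0` the signs persist and the angle is
  -- within `ε`. The surface is then compatible with `f`, so by `hcon` its angle is the initial one,
  -- and by rigidity all determinants are again the initial ones.
  have hall : Icc (0 : ℝ) 1 ⊆ Φ ⁻¹' {Φ 0} := by
    apply IsClosed.Icc_subset_of_forall_exists_gt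
    · rw [inter_comm]
      exact hΦ.preimage_isClosed_of_isClosed isClosed_Icc isClosed_singleton
    · rfl
    · rintro t ⟨ht, ht0, ht1⟩ y hy
      have ht : Φ t = Φ 0 := ht
      have hcont := hΦ t ⟨ht0, ht1.le⟩
      have h1 : ∀ᶠ s in 𝓝[Icc 0 1] t, |(Φ s).1 - (Φ 0).1| < ε := by
        have : Tendsto (fun s => |(Φ s).1 - (Φ 0).1|) (𝓝[Icc 0 1] t) (𝓝 |(Φ t).1 - (Φ 0).1|) :=
          ((continuous_fst.continuousAt.tendsto.comp hcont).sub_const _).abs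
        rw [ht, sub_self, abs_zero] at this
        exact this.eventually_lt_const hε
      have h2 : ∀ᶠ s in 𝓝[Icc 0 1] t, ∀ x, 0 < (Φ s).2 x * (Φ 0).2 x := by
        rw [eventually_all]
        intro x
        have : Tendsto (fun s => (Φ s).2 x * (Φ 0).2 x) (𝓝[Icc 0 1] t)
            (𝓝 ((Φ t).2 x * (Φ 0).2 x)) :=
          ((((continuous_apply x).comp continuous_snd).continuousAt.tendsto.comp hcont).mul_const _)
        rw [ht] at this
        exact this.eventually_const_lt (mul_self_pos.2 (hne x))
      have h3 : ∀ᶠ s in 𝓝[>] t, s ∈ Icc (0 : ℝ) 1 ∧ s ∈ Ioc t y := by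
        filter_upwards [Ioo_mem_nhdsGT (lt_min ht1 hy)] with s hs
        have := hs.2
        rw [lt_min_iff] at this
        exact ⟨⟨ht0.trans hs.1.le, this.1.le⟩, hs.1, this.2.le⟩
      have hle : 𝓝[>] t ≤ 𝓝[Icc 0 1] t := by
        rw [nhdsWithin, nhdsWithin]
        refine le_inf inf_le_left (le_principal_iff.2 ?_)
        exact h3.mono fun s hs => hs.1
      obtain ⟨s, hs1, hs2, hs3, hs4⟩ := ((h1.filter_mono hle).and ((h2.filter_mono hle).and h3)).exists
      refine ⟨s, ?_, hs4⟩
      have hC := compat s hs3 hs2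
      have hx : rowDot (toConf (F s)) i₀ j₀ = rowDot (toConf f) i₀ j₀ := by
        by_contra hx
        have := hcon s hs3 hC hx
        simp only [Φ, hF.start] at hs1
        exact this.not_gt hs1
      have hx0 := (hC.rowDot_iff hi₀ hj₀).2 hx
      refine Prod.ext ?_ (funext fun x => ?_)
      · simp only [Φ, hF.start, hx]
      · simp only [Φ, hF.start]
        exact hC.starDet_eq hm hn hx0 (by omega) (by omega) _
  obtain ⟨t, ht, htc⟩ := hc
  apply htc
  have he : Φ t = Φ 0 := hall ht
  have hC := compat t ht fun x => by rw [he]; exact mul_self_pos.2 (hne x)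
  have hx : rowDot (toConf (F t)) i₀ j₀ = rowDot (toConf f) i₀ j₀ := by
    have := congrArg Prod.fst he
    simpa only [Φ, hF.start] using this
  intro p q
  rw [dist_eq_dist_iff, ← toConf_val (f := F t), ← toConf_val (f := F t), ← toConf_val (f := f),
    ← toConf_val (f := f)]
  obtain ⟨T, o, o', hT, e⟩ := hC.exists_isRotation hm hn ((hC.rowDot_iff hi₀ hj₀).2 hx)
  rw [← e _ _ (by omega) (by omega), ← e _ _ (by omega) (by omega), hT.apply_sub, hT.map_dot]

end

/-! ### Analytic curves and trilateration -/

/-- A curve in space whose coordinates are analytic at `0`. -/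
def AnalyticCurve (A : ℝ → E3) : Prop := ∀ k, AnalyticAt ℝ (fun s => A s k) 0

namespace AnalyticCurve

variable {A B C : ℝ → E3}

lemma const (v : E3) : AnalyticCurve fun _ => v := fun _ => analyticAt_const

lemma add (hA : AnalyticCurve A) (hB : AnalyticCurve B) : AnalyticCurve fun s => A s + B s :=
  fun k => (hA k).add (hB k)

lemma sub (hA : AnalyticCurve A) (hB : AnalyticCurve B) : AnalyticCurve fun s => A s - B s :=
  fun k => (hA k).sub (hB k)

lemma smul {φ : ℝ → ℝ} (hφ : AnalyticAt ℝ φ 0) (hA : AnalyticCurve A) :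
    AnalyticCurve fun s => φ s • A s :=
  fun k => hφ.mul (hA k)

lemma cross (hA : AnalyticCurve A) (hB : AnalyticCurve B) :
    AnalyticCurve fun s => cross (A s) (B s) := by
  have hA' : ∀ k, AnalyticAt ℝ (fun s => A s k) 0 := hA
  have hB' : ∀ k, AnalyticAt ℝ (fun s => B s k) 0 := hB
  intro k
  fin_cases k
  · exact ((hA 1).mul (hB 2)).sub ((hA 2).mul (hB 1))
  · exact ((hA 2).mul (hB 0)).sub ((hA 0).mul (hB 2))
  · exact ((hA 0).mul (hB 1)).sub ((hA 1).mul (hB 0))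

lemma dot (hA : AnalyticCurve A) (hB : AnalyticCurve B) :
    AnalyticAt ℝ (fun s => dot (A s) (B s)) 0 :=
  (((hA 0).mul (hB 0)).add ((hA 1).mul (hB 1))).add ((hA 2).mul (hB 2))

lemma gram2 (hA : AnalyticCurve A) (hB : AnalyticCurve B) :
    AnalyticAt ℝ (fun s => gram2 (A s) (B s)) 0 :=
  ((hA.dot hA).mul (hB.dot hB)).sub ((hA.dot hB).pow 2)

lemma det3 (hA : AnalyticCurve A) (hB : AnalyticCurve B) (hC : AnalyticCurve C) :
    AnalyticAt ℝ (fun s => det3 (A s) (B s) (C s)) 0 := by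
  have h := hA.dot (hB.cross hC)
  refine h.congr (Eventually.of_forall fun s => ?_)
  simp only [SkewQuad.dot, SkewQuad.det3, cross_zero, cross_one, cross_two]
  ring

lemma eventually_continuousAt (hA : AnalyticCurve A) : ∀ᶠ s in 𝓝 0, ContinuousAt A s := by
  have h : ∀ᶠ s in 𝓝 (0 : ℝ), ∀ k, ContinuousAt (fun s => A s k) s :=
    eventually_all.2 fun k => (hA k).eventually_analyticAt.mono fun s hs => hs.continuousAt
  filter_upwards [h] with s hs
  have h1 : ContinuousAt (fun s => (A s).ofLp) s := continuousAt_pi.2 hs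
  exact (PiLp.continuous_toLp 2 fun _ : Fin 3 => ℝ).continuousAt.comp h1

end AnalyticCurve

lemma dot_frame_left (u v : E3) (p q r : ℝ) :
    dot (p • cross v (cross u v) + q • cross (cross u v) u + r • cross u v) u =
      gram2 u v * p := by
  simp [gram2, dot]; ring

lemma dot_frame_right (u v : E3) (p q r : ℝ) :
    dot (p • cross v (cross u v) + q • cross (cross u v) u + r • cross u v) v =
      gram2 u v * q := by
  simp [gram2, dot]; ring

lemma dot_smul_left (c : ℝ) (a b : E3) : dot (c • a) b = c * dot a b := by
  simp only [dot, PiLp.smul_apply, smul_eq_mul]; ring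

/-- An analytic curve with prescribed coordinates relative to a moving frame. -/
lemma exists_curve_of_frame {A B : ℝ → E3} (hA : AnalyticCurve A) (hB : AnalyticCurve B)
    {α β γ : ℝ → ℝ} (hα : AnalyticAt ℝ α 0) (hβ : AnalyticAt ℝ β 0) (hγ : AnalyticAt ℝ γ 0)
    {w₀ : E3} (hg : gram2 (A 0) (B 0) ≠ 0) (hα₀ : α 0 = dot w₀ (A 0)) (hβ₀ : β 0 = dot w₀ (B 0))
    (hγ₀ : γ 0 = det3 (A 0) (B 0) w₀) :
    ∃ w, AnalyticCurve w ∧ w 0 = w₀ ∧ ∀ᶠ s in 𝓝 0, gram2 (A s) (B s) ≠ 0 ∧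
      dot (w s) (A s) = α s ∧ dot (w s) (B s) = β s ∧
      gram2 (A s) (B s) * dot (w s) (w s) = α s * α s * dot (B s) (B s)
        + β s * β s * dot (A s) (A s) - (α s * β s + β s * α s) * dot (A s) (B s)
        + γ s * γ s := by
  have hn := hA.cross hB
  refine ⟨fun s => (gram2 (A s) (B s))⁻¹ • (α s • cross (B s) (cross (A s) (B s))
    + β s • cross (cross (A s) (B s)) (A s) + γ s • cross (A s) (B s)), ?_, ?_, ?_⟩
  · exact .smul ((hA.gram2 hB).inv hg)
      (((AnalyticCurve.smul hα (hB.cross hn)).add (.smul hβ (hn.cross hA))).add (.smul hγ hn))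
  · rw [inv_smul_eq_iff₀ hg, hα₀, hβ₀, hγ₀, gram2_smul_eq]
  · filter_upwards [(hA.gram2 hB).continuousAt.eventually_ne hg] with s hs
    refine ⟨hs, ?_, ?_, ?_⟩
    · rw [dot_smul_left, dot_frame_left, inv_mul_cancel_left₀ hs]
    · rw [dot_smul_left, dot_frame_right, inv_mul_cancel_left₀ hs]
    · rw [dot_smul_left, dot_comm, dot_smul_left, gram2_mul_dot_frame, inv_mul_cancel_left₀ hs,
        mul_inv_cancel_left₀ hs]

/-- Analytic trilateration. -/
lemma exists_curve_of_dot {A B : ℝ → E3} (hA : AnalyticCurve A) (hB : AnalyticCurve B)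
    {α : ℝ → ℝ} (hα : AnalyticAt ℝ α 0) {w₀ : E3} (hα₀ : α 0 = dot w₀ (A 0))
    (hd : det3 (A 0) (B 0) w₀ ≠ 0) :
    ∃ w, AnalyticCurve w ∧ w 0 = w₀ ∧ ∀ᶠ s in 𝓝 0, dot (w s) (A s) = α s ∧
      dot (w s) (B s) = dot w₀ (B 0) ∧ dot (w s) (w s) = dot w₀ w₀ := by
  set d := det3 (A 0) (B 0) w₀ with hd'
  set β := dot w₀ (B 0) with hβ
  -- By `gram2_mul_dot`, the length of the curve stays constant exactly when the square of its third
  -- coordinate equals `h`.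
  let h : ℝ → ℝ := fun s => gram2 (A s) (B s) * dot w₀ w₀ - (α s * α s * dot (B s) (B s)
        + β * β * dot (A s) (A s) - (α s * β + β * α s) * dot (A s) (B s))
  have hh : AnalyticAt ℝ h 0 := by
    have h1 := hA.gram2 hB
    have h2 := hA.dot hA
    have h3 := hA.dot hB
    have h4 := hB.dot hB
    simp only [h]
    fun_prop
  have hh0 : h 0 = d * d := by
    have := gram2_mul_dot (A 0) (B 0) w₀ w₀
    simp only [h]
    rw [this, hα₀]; ring
  have hpos : 0 < h 0 := by rw [hh0]; exact mul_self_pos.2 hd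
  -- Dividing by `h 0 = d * d` keeps the square root analytic, its argument being near `1`, and the
  -- factor `d` selects the branch through `w₀`.
  have hγ : AnalyticAt ℝ (fun s => d * Real.sqrt (h s / h 0)) 0 := by
    have h1 : AnalyticAt ℝ (fun s => h s / h 0) 0 := hh.div analyticAt_const hpos.ne'
    have h2 : AnalyticAt ℝ Real.sqrt (h 0 / h 0) :=
      (Real.contDiffAt_sqrt (by rw [div_self hpos.ne']; exact one_ne_zero)).analyticAt
    exact analyticAt_const.mul (h2.comp (f := fun s => h s / h 0) h1)
  obtain ⟨w, hw, hw0, hw'⟩ := exists_curve_of_frame hA hB hα (β := fun _ => β) analyticAt_const hγ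
    (w₀ := w₀) (gram2_ne_zero hd) hα₀ rfl (by rw [div_self hpos.ne', Real.sqrt_one, mul_one])
  refine ⟨w, hw, hw0, ?_⟩
  filter_upwards [hw', hh.continuousAt.eventually_const_lt hpos] with s ⟨hg, h1, h2, h3⟩ hs
  refine ⟨h1, h2, mul_left_cancel₀ hg ?_⟩
  have h4 : d * Real.sqrt (h s / h 0) * (d * Real.sqrt (h s / h 0)) = h s := by
    have : Real.sqrt (h s / h 0) * Real.sqrt (h s / h 0) = h s / h 0 :=
      Real.mul_self_sqrt (div_nonneg hs.le hpos.le)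
    calc _ = d * d * (Real.sqrt (h s / h 0) * Real.sqrt (h s / h 0)) := by ring
      _ = h s := by rw [this, ← hh0]; field_simp
  rw [h3, h4]
  simp only [h]
  ring

/-- A point rigidly attached to a moving frame. -/
lemma exists_curve_of_rigid {A B : ℝ → E3} (hA : AnalyticCurve A) (hB : AnalyticCurve B)
    (w₀ : E3) (hg : gram2 (A 0) (B 0) ≠ 0)
    (hAA : ∀ᶠ s in 𝓝 0, dot (A s) (A s) = dot (A 0) (A 0))
    (hAB : ∀ᶠ s in 𝓝 0, dot (A s) (B s) = dot (A 0) (B 0))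
    (hBB : ∀ᶠ s in 𝓝 0, dot (B s) (B s) = dot (B 0) (B 0)) :
    ∃ w, AnalyticCurve w ∧ w 0 = w₀ ∧ ∀ᶠ s in 𝓝 0, dot (w s) (A s) = dot w₀ (A 0) ∧
      dot (w s) (B s) = dot w₀ (B 0) ∧ dot (w s) (w s) = dot w₀ w₀ := by
  obtain ⟨w, hw, hw0, hw'⟩ := exists_curve_of_frame hA hB (α := fun _ => dot w₀ (A 0))
    (β := fun _ => dot w₀ (B 0)) (γ := fun _ => det3 (A 0) (B 0) w₀) (w₀ := w₀) analyticAt_const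
    analyticAt_const analyticAt_const hg rfl rfl rfl
  refine ⟨w, hw, hw0, ?_⟩
  filter_upwards [hw', hAA, hAB, hBB] with s ⟨hs, h1, h2, h3⟩ hAA hAB hBB
  refine ⟨h1, h2, mul_left_cancel₀ hg ?_⟩
  have e : gram2 (A s) (B s) = gram2 (A 0) (B 0) := by simp only [gram2, hAA, hAB, hBB]
  rw [← e, h3, hAA, hAB, hBB, e, gram2_mul_dot]

namespace SameDist

variable {p q r s p' q' r' s' : E3}

lemma rotate (h : SameDist p q r s p' q' r' s') : SameDist q r s p q' r' s' p' := by
  refine ⟨h.qr, h.qs, ?_, h.rs, ?_, ?_⟩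
  · rw [dot_sub_comm, h.pq, dot_sub_comm]
  · rw [dot_sub_comm, h.pr, dot_sub_comm]
  · rw [dot_sub_comm, h.ps, dot_sub_comm]

lemma dot_qq (h : SameDist p q r s p' q' r' s') :
    dot (q - p) (q - p) = dot (q' - p') (q' - p') := by
  rw [dot_sub_comm, h.pq, dot_sub_comm]

lemma dot_ss (h : SameDist p q r s p' q' r' s') :
    dot (s - p) (s - p) = dot (s' - p') (s' - p') := by
  rw [dot_sub_comm, h.ps, dot_sub_comm]

/-- Equal dot products of the vectors from one of the four points give equal distances. -/
lemma of_dot {a o b a' o' b' : E3} (haa : dot a a = dot a' a') (hoo : dot o o = dot o' o')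
    (hbb : dot b b = dot b' b') (hoa : dot o a = dot o' a') (hob : dot o b = dot o' b')
    (hab : dot a b = dot a' b') :
    SameDist p (p + a) (p + o) (p + b) p' (p' + a') (p' + o') (p' + b') := by
  have e : ∀ p x : E3, dot (p - (p + x)) (p - (p + x)) = dot x x := by
    intro p x
    rw [dot_sub_comm, add_sub_cancel_left]
  constructor <;>
    simp only [e, add_sub_add_left_eq_sub, dot_sub_sub, haa, hoo, hbb, hoa, hob, hab,
      dot_comm a o, dot_comm a' o']

end SameDist

lemma dot_sub_eq_of_dot_eq {c x y c' x' y' : E3}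
    (hx : dot (x - c) (x - c) = dot (x' - c') (x' - c'))
    (hy : dot (y - c) (y - c) = dot (y' - c') (y' - c'))
    (hxy : dot (x - c) (y - c) = dot (x' - c') (y' - c')) :
    dot (x - y) (x - y) = dot (x' - y') (x' - y') := by
  rw [← sub_sub_sub_cancel_right x y c, ← sub_sub_sub_cancel_right x' y' c',
    dot_sub_sub (x - c), dot_sub_sub (x' - c'), hx, hy, hxy]

/-! ### Analytic deformations and their extension -/

/-- A one-parameter analytic deformation near `0` of the `m × n` part of a grid with rigid quads,
parametrised by an angle at the vertex `(1, 1)`. -/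
structure Germ (m n : ℕ) (f : Conf) (F : ℝ → Conf) : Prop where
  analytic : ∀ i j, i ≤ m → j ≤ n → AnalyticCurve fun s => F s i j
  start : ∀ i j, i ≤ m → j ≤ n → F 0 i j = f i j
  quad : ∀ i j, i < m → j < n → ∀ᶠ s in 𝓝 0, QuadDist (F s) f i j
  param : ∀ᶠ s in 𝓝 0, rowDot (F s) 0 0 = rowDot f 0 0 + s

lemma det3_cycle (a b c : E3) : det3 a b c = det3 c a b := by simp only [det3]; ring

lemma det3_swap (a b c : E3) : det3 a c b = -det3 a b c := by simp only [det3]; ring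

/-- The vertex of a spatial star over a moving pair of edges. -/
lemma exists_star_vertex {C P Q : ℝ → E3} (hC : AnalyticCurve C) (hP : AnalyticCurve P)
    (hQ : AnalyticCurve Q) {c p q o : E3} (hc : C 0 = c) (hp : P 0 = p) (hq : Q 0 = q)
    {φ : ℝ → ℝ} (hφ : AnalyticAt ℝ φ 0) (hφ0 : φ 0 = dot (o - c) (p - c))
    (hd : det3 (p - c) (q - c) (o - c) ≠ 0) :
    ∃ O, AnalyticCurve O ∧ O 0 = o ∧ ∀ᶠ s in 𝓝 0, dot (O s - C s) (P s - C s) = φ s ∧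
      dot (O s - C s) (Q s - C s) = dot (o - c) (q - c) ∧
      dot (O s - C s) (O s - C s) = dot (o - c) (o - c) := by
  subst hc hp hq
  obtain ⟨w, hw, hw0, hw'⟩ := exists_curve_of_dot (hP.sub hC) (hQ.sub hC) hφ hφ0 hd
  refine ⟨fun s => C s + w s, hC.add hw, ?_, ?_⟩
  · simp only [hw0, add_sub_cancel]
  · simp only [add_sub_cancel_left]
    exact hw'

/-- The fourth vertex of a rigid quad with three moving vertices. -/
lemma exists_quad_vertex {C P Q : ℝ → E3} (hC : AnalyticCurve C) (hP : AnalyticCurve P)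
    (hQ : AnalyticCurve Q) {c p q : E3} (o : E3) (hc : C 0 = c) (hp : P 0 = p) (hq : Q 0 = q)
    (hpp : ∀ᶠ s in 𝓝 0, dot (P s - C s) (P s - C s) = dot (p - c) (p - c))
    (hpq : ∀ᶠ s in 𝓝 0, dot (P s - C s) (Q s - C s) = dot (p - c) (q - c))
    (hqq : ∀ᶠ s in 𝓝 0, dot (Q s - C s) (Q s - C s) = dot (q - c) (q - c))
    (hg : gram2 (p - c) (q - c) ≠ 0) :
    ∃ O, AnalyticCurve O ∧ O 0 = o ∧
      ∀ᶠ s in 𝓝 0, SameDist (C s) (P s) (O s) (Q s) c p o q := by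
  subst hc hp hq
  obtain ⟨w, hw, hw0, hw'⟩ := exists_curve_of_rigid (hP.sub hC) (hQ.sub hC) (o - C 0) hg hpp hpq hqq
  refine ⟨fun s => C s + w s, hC.add hw, ?_, ?_⟩
  · simp only [hw0, add_sub_cancel]
  · filter_upwards [hw', hpp, hpq, hqq] with s hs hpp hpq hqq
    have := SameDist.of_dot (p := C s) (p' := C 0) hpp hs.2.2 hqq hs.1 hs.2.1 hpq
    simpa only [add_sub_cancel] using this

/-- The quad `(1, 0)` stays fixed. The edge from `(1, 1)` to `(0, 1)` swings with prescribed
`rowDot`, keeping its angle with the edge to `(1, 0)`, and carries the quad `(0, 0)` along. -/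
theorem exists_germ_two_one {f : Conf} (hd : starDet f 0 0 2 ≠ 0) : ∃ F, Germ 2 1 f F := by
  have hd' : det3 (f 2 1 - f 1 1) (f 1 0 - f 1 1) (f 0 1 - f 1 1) ≠ 0 := by
    rw [det3_cycle, det3_swap]
    exact neg_ne_zero.2 hd
  obtain ⟨W, hW, hW0, hW'⟩ := exists_star_vertex (.const (f 1 1)) (.const (f 2 1)) (.const (f 1 0))
    rfl rfl rfl (φ := fun s => dot (f 0 1 - f 1 1) (f 2 1 - f 1 1) + s) (by fun_prop)
    (add_zero _) hd'
  obtain ⟨V, hV, hV0, hV'⟩ := exists_quad_vertex (.const (f 1 1)) hW (.const (f 1 0)) (f 0 0)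
    rfl hW0 rfl (by filter_upwards [hW'] with s hs; exact hs.2.2)
    (by filter_upwards [hW'] with s hs; exact hs.2.1) (by simp)
    (gram2_ne_zero (c := f 2 1 - f 1 1) hd)
  let F : ℝ → Conf := fun s i j =>
    if i = 0 ∧ j = 1 then W s else if i = 0 ∧ j = 0 then V s else f i j
  have F01 : ∀ s, F s 0 1 = W s := fun s => by simp [F]
  have F00 : ∀ s, F s 0 0 = V s := fun s => by simp [F]
  have Fs : ∀ s i j, F s (i + 1) j = f (i + 1) j := fun s i j => by simp [F]
  refine ⟨F, ?_, ?_, ?_, ?_⟩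
  · intro i j hi hj
    rcases i with _ | i
    · interval_cases j
      · simp only [F00]; exact hV
      · simp only [F01]; exact hW
    · simp only [Fs]; exact .const _
  · intro i j hi hj
    rcases i with _ | i
    · interval_cases j
      · rw [F00, hV0]
      · rw [F01, hW0]
    · rw [Fs]
  · intro i j hi hj
    obtain rfl : j = 0 := by omega
    interval_cases i
    · filter_upwards [hV'] with s hs
      simp only [QuadDist, Fs, F00, F01, zero_add]
      exact hs.rotate.rotate
    · refine Eventually.of_forall fun s => ?_
      simp only [QuadDist, Fs]
      constructor <;> rfl
  · filter_upwards [hW'] with s hs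
    have e : rowDot (F s) 0 0 = dot (f 2 1 - f 1 1) (W s - f 1 1) := by
      simp only [rowDot, zero_add, F01, Fs]
    rw [e, dot_comm, hs.1, dot_comm]
    rfl

/-- The middle vertex of the new column has constant angles with the two moving edges at `(1, k +
1)`; the outer two complete rigid quads. No closing condition arises. -/
theorem Germ.succ_col {f : Conf} {F : ℝ → Conf} {k : ℕ} (h : Germ 2 (k + 1) f F)
    (hd : starDet f 0 k 0 ≠ 0) : ∃ F', Germ 2 (k + 2) f F' := by
  have hd0 : det3 (f 2 (k + 1) - f 1 (k + 1)) (f 1 (k + 2) - f 1 (k + 1))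
    (f 0 (k + 1) - f 1 (k + 1)) ≠ 0 := hd
  have hC := h.analytic 1 (k + 1) (by omega) le_rfl
  have hP := h.analytic 2 (k + 1) (by omega) le_rfl
  have hQ := h.analytic 0 (k + 1) (by omega) le_rfl
  have hC0 := h.start 1 (k + 1) (by omega) le_rfl
  have hP0 := h.start 2 (k + 1) (by omega) le_rfl
  have hQ0 := h.start 0 (k + 1) (by omega) le_rfl
  have hd' : det3 (f 2 (k + 1) - f 1 (k + 1)) (f 0 (k + 1) - f 1 (k + 1))
      (f 1 (k + 2) - f 1 (k + 1)) ≠ 0 := by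
    rw [det3_swap]; exact neg_ne_zero.2 hd0
  obtain ⟨W, hW, hW0, hW'⟩ := exists_star_vertex hC hP hQ hC0 hP0 hQ0 analyticAt_const rfl hd'
  obtain ⟨V₂, hV₂, hV₂0, hV₂'⟩ := exists_quad_vertex hC hP hW (f 2 (k + 2)) hC0 hP0 hW0
    (by filter_upwards [h.quad 1 k (by omega) (by omega)] with s hs
        exact hs.rotate.rotate.rotate.dot_ss)
    (by filter_upwards [hW'] with s hs; rw [dot_comm, hs.1, dot_comm])
    (by filter_upwards [hW'] with s hs; exact hs.2.2) (gram2_ne_zero hd0)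
  obtain ⟨V₀, hV₀, hV₀0, hV₀'⟩ := exists_quad_vertex hC hW hQ (f 0 (k + 2)) hC0 hW0 hQ0
    (by filter_upwards [hW'] with s hs; exact hs.2.2)
    (by filter_upwards [hW'] with s hs; exact hs.2.1)
    (by filter_upwards [h.quad 0 k (by omega) (by omega)] with s hs
        exact hs.rotate.rotate.dot_qq)
    (gram2_ne_zero (c := f 2 (k + 1) - f 1 (k + 1)) (by rw [det3_cycle]; exact hd0))
  let F' : ℝ → Conf := fun s i j =>
    if j ≤ k + 1 then F s i j else if i = 0 then V₀ s else if i = 1 then W s else V₂ s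
  have Fold : ∀ s i j, j ≤ k + 1 → F' s i j = F s i j := fun s i j hj => by simp [F', hj]
  have F0 : ∀ s, F' s 0 (k + 2) = V₀ s := fun s => by simp [F']
  have F1 : ∀ s, F' s 1 (k + 2) = W s := fun s => by simp [F']
  have F2 : ∀ s, F' s 2 (k + 2) = V₂ s := fun s => by simp [F']
  refine ⟨F', ?_, ?_, ?_, ?_⟩
  · intro i j hi hj
    rcases (by omega : j ≤ k + 1 ∨ j = k + 2) with hj | rfl
    · simp only [Fold _ _ _ hj]; exact h.analytic i j hi hj
    · interval_cases i
      · simp only [F0]; exact hV₀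
      · simp only [F1]; exact hW
      · simp only [F2]; exact hV₂
  · intro i j hi hj
    rcases (by omega : j ≤ k + 1 ∨ j = k + 2) with hj | rfl
    · rw [Fold _ _ _ hj]; exact h.start i j hi hj
    · interval_cases i
      · rw [F0, hV₀0]
      · rw [F1, hW0]
      · rw [F2, hV₂0]
  · intro i j hi hj
    rcases (by omega : j < k + 1 ∨ j = k + 1) with hj | rfl
    · simp only [QuadDist, Fold _ _ j hj.le, Fold _ _ (j + 1) hj]
      exact h.quad i j hi hj
    · interval_cases i
      · filter_upwards [hV₀'] with s hs
        simp only [QuadDist, Fold _ _ (k + 1) le_rfl, zero_add, F0, F1]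
        exact hs.rotate.rotate.rotate
      · filter_upwards [hV₂'] with s hs
        simp only [QuadDist, Fold _ _ (k + 1) le_rfl, Nat.reduceAdd, F2, F1]
        exact hs
  · simp only [rowDot, Fold _ _ (0 + 1) (by omega)]
    exact h.param

/-- The edge vectors between consecutive rows at `(i + 1, j + 1)` have the right length and the
right angles with the edges of row `i + 1`. -/
structure RowCompat (g g' : Conf) (i j : ℕ) : Prop where
  self : dot (starEdge g i j 0) (starEdge g i j 0) = dot (starEdge g' i j 0) (starEdge g' i j 0)
  right : dot (starEdge g i j 0) (starEdge g i j 1) = dot (starEdge g' i j 0) (starEdge g' i j 1)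
  left : dot (starEdge g i j 0) (starEdge g i j 3) = dot (starEdge g' i j 0) (starEdge g' i j 3)

/-- The inner vertices of the new row are placed independently of each other. The quads at the two
ends contain only one of them each, so they can be completed rigidly. -/
theorem Germ.exists_succ_row {f : Conf} {F : ℝ → Conf} {k l : ℕ} (h : Germ (k + 2) (l + 2) f F)
    (hd : ∀ j ≤ l, starDet f (k + 1) j 3 ≠ 0) :
    ∃ F' : ℝ → Conf, (∀ s i j, i ≤ k + 2 → F' s i j = F s i j) ∧
      (∀ j ≤ l + 2, AnalyticCurve fun s => F' s (k + 3) j) ∧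
      (∀ j ≤ l + 2, F' 0 (k + 3) j = f (k + 3) j) ∧
      (∀ j ≤ l, ∀ᶠ s in 𝓝 0, RowCompat (F' s) f (k + 1) j) ∧
      (∀ᶠ s in 𝓝 0, QuadDist (F' s) f (k + 2) 0) ∧
      ∀ᶠ s in 𝓝 0, QuadDist (F' s) f (k + 2) (l + 1) := by
  have hd0 : ∀ j ≤ l, det3 (f (k + 2) j - f (k + 2) (j + 1)) (f (k + 3) (j + 1) - f (k + 2) (j + 1))
    (f (k + 2) (j + 2) - f (k + 2) (j + 1)) ≠ 0 := hd
  have hA : ∀ j ≤ l + 2, AnalyticCurve fun s => F s (k + 2) j := fun j hj =>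
    h.analytic (k + 2) j le_rfl hj
  have hA0 : ∀ j ≤ l + 2, F 0 (k + 2) j = f (k + 2) j := fun j hj => h.start (k + 2) j le_rfl hj
  have hrow : ∀ j, ∃ W, j ≤ l → AnalyticCurve W ∧ W 0 = f (k + 3) (j + 1) ∧ ∀ᶠ s in 𝓝 0,
      dot (W s - F s (k + 2) (j + 1)) (F s (k + 2) (j + 2) - F s (k + 2) (j + 1)) =
        dot (f (k + 3) (j + 1) - f (k + 2) (j + 1)) (f (k + 2) (j + 2) - f (k + 2) (j + 1)) ∧
      dot (W s - F s (k + 2) (j + 1)) (F s (k + 2) j - F s (k + 2) (j + 1)) =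
        dot (f (k + 3) (j + 1) - f (k + 2) (j + 1)) (f (k + 2) j - f (k + 2) (j + 1)) ∧
      dot (W s - F s (k + 2) (j + 1)) (W s - F s (k + 2) (j + 1)) =
        dot (f (k + 3) (j + 1) - f (k + 2) (j + 1)) (f (k + 3) (j + 1) - f (k + 2) (j + 1)) := by
    intro j
    by_cases hj : j ≤ l
    · obtain ⟨W, hW⟩ := exists_star_vertex (hA (j + 1) (by omega)) (hA (j + 2) (by omega))
        (hA j (by omega)) (hA0 (j + 1) (by omega)) (hA0 (j + 2) (by omega)) (hA0 j (by omega))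
        analyticAt_const rfl (o := f (k + 3) (j + 1)) (by rw [det3_cycle, det3_cycle]; exact hd0 j hj)
      exact ⟨W, fun _ => hW⟩
    -- A default value, so that `choose` yields a family indexed by all `j`.
    · exact ⟨fun _ => 0, fun hj' => absurd hj' hj⟩
  choose W hW using hrow
  obtain ⟨V₀, hV₀, hV₀0, hV₀'⟩ := exists_quad_vertex (hA 1 (by omega)) (hA 0 (by omega))
    (hW 0 (by omega)).1 (f (k + 3) 0) (hA0 1 (by omega)) (hA0 0 (by omega)) (hW 0 (by omega)).2.1
    (by filter_upwards [h.quad (k + 1) 0 (by omega) (by omega)] with s hs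
        exact hs.rotate.rotate.dot_ss)
    (by filter_upwards [(hW 0 (by omega)).2.2] with s hs; rw [dot_comm, hs.2.1, dot_comm])
    (by filter_upwards [(hW 0 (by omega)).2.2] with s hs; exact hs.2.2)
    (gram2_ne_zero (hd0 0 (by omega)))
  obtain ⟨V₁, hV₁, hV₁0, hV₁'⟩ := exists_quad_vertex (hA (l + 1) (by omega))
    (hW l le_rfl).1 (hA (l + 2) (by omega)) (f (k + 3) (l + 2)) (hA0 (l + 1) (by omega))
    (hW l le_rfl).2.1 (hA0 (l + 2) (by omega))
    (by filter_upwards [(hW l le_rfl).2.2] with s hs; exact hs.2.2)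
    (by filter_upwards [(hW l le_rfl).2.2] with s hs; exact hs.1)
    (by filter_upwards [h.quad (k + 1) (l + 1) (by omega) (by omega)] with s hs
        exact hs.rotate.dot_qq)
    (gram2_ne_zero (c := f (k + 2) l - f (k + 2) (l + 1)) (by rw [det3_cycle]; exact hd0 l le_rfl))
  let F' : ℝ → Conf := fun s i j =>
    if i ≤ k + 2 then F s i j else if j = 0 then V₀ s else if j = l + 2 then V₁ s else W (j - 1) s
  have Fold : ∀ s i j, i ≤ k + 2 → F' s i j = F s i j := fun s i j hi => by simp [F', hi]
  have F0 : ∀ s, F' s (k + 3) 0 = V₀ s := fun s => by simp [F']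
  have F1 : ∀ s, F' s (k + 3) (l + 2) = V₁ s := fun s => by simp [F']
  have FW : ∀ s j, j ≤ l → F' s (k + 3) (j + 1) = W j s := fun s j hj => by
    have : j ≠ l + 1 := by omega
    simp [F', this]
  refine ⟨F', Fold, ?_, ?_, ?_, ?_, ?_⟩
  · intro j hj
    rcases (by omega : j = 0 ∨ j = l + 2 ∨ j ≠ 0 ∧ j - 1 ≤ l) with rfl | rfl | ⟨h0, hl⟩
    · simp only [F0]; exact hV₀
    · simp only [F1]; exact hV₁
    · obtain ⟨j, rfl⟩ := Nat.exists_eq_succ_of_ne_zero h0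
      simp only [Nat.succ_eq_add_one, FW _ j hl]; exact (hW j hl).1
  · intro j hj
    rcases (by omega : j = 0 ∨ j = l + 2 ∨ j ≠ 0 ∧ j - 1 ≤ l) with rfl | rfl | ⟨h0, hl⟩
    · rw [F0, hV₀0]
    · rw [F1, hV₁0]
    · obtain ⟨j, rfl⟩ := Nat.exists_eq_succ_of_ne_zero h0
      simp only [Nat.succ_eq_add_one, FW _ j hl]; exact (hW j hl).2.1
  · intro j hj
    filter_upwards [(hW j hj).2.2] with s hs
    have e0 : starEdge (F' s) (k + 1) j 0 = W j s - F s (k + 2) (j + 1) := by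
      rw [← FW s j hj, ← Fold s (k + 2) _ le_rfl]; rfl
    have e1 : starEdge (F' s) (k + 1) j 1 = F s (k + 2) (j + 2) - F s (k + 2) (j + 1) := by
      rw [← Fold s (k + 2) _ le_rfl, ← Fold s (k + 2) _ le_rfl]; rfl
    have e3 : starEdge (F' s) (k + 1) j 3 = F s (k + 2) j - F s (k + 2) (j + 1) := by
      rw [← Fold s (k + 2) _ le_rfl, ← Fold s (k + 2) _ le_rfl]; rfl
    constructor
    · rw [e0]; exact hs.2.2
    · rw [e0, e1]; exact hs.1
    · rw [e0, e3]; exact hs.2.1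
  · filter_upwards [hV₀'] with s hs
    simp only [QuadDist, Fold _ (k + 2) _ le_rfl, F0, FW s 0 (by omega), show k + 2 + 1 = k + 3 from rfl]
    exact hs.rotate
  · filter_upwards [hV₁'] with s hs
    simp only [QuadDist, Fold _ (k + 2) _ le_rfl, F1, FW s l le_rfl, show k + 2 + 1 = k + 3 from rfl,
      show l + 1 + 1 = l + 2 from rfl]
    exact hs

lemma eventually_forall_lt_lt {m n : ℕ} {p : ℕ → ℕ → ℝ → Prop} {L : Filter ℝ}
    (h : ∀ i j, i < m → j < n → ∀ᶠ s in L, p i j s) :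
    ∀ᶠ s in L, ∀ i j, i < m → j < n → p i j s := by
  have h1 : ∀ᶠ s in L, ∀ x : Fin m × Fin n, p x.1 x.2 s :=
    eventually_all.2 fun x => h x.1 x.2 x.1.2 x.2.2
  exact h1.mono fun s hs i j hi hj => hs (⟨i, hi⟩, ⟨j, hj⟩)

section

variable {f : Conf} {F : ℝ → Conf} {i j : ℕ}

/-- As for motions, with persistence of the sign near `0` replacing connectedness. -/
lemma eventually_quadCompat (ha : ∀ k l, k ≤ i + 1 → l ≤ j + 1 → AnalyticCurve fun s => F s k l)
    (h0 : ∀ k l, k ≤ i + 1 → l ≤ j + 1 → F 0 k l = f k l)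
    (hq : ∀ᶠ s in 𝓝 0, QuadDist (F s) f i j) : ∀ᶠ s in 𝓝 0, QuadCompat (F s) f i j := by
  have ha0 := ha i j (by omega) (by omega)
  have hc : ContinuousAt (fun s => quadDet (F s) i j) 0 :=
    (((ha (i + 1) j (by omega) (by omega)).sub ha0).det3
      ((ha (i + 1) (j + 1) (by omega) (by omega)).sub ha0)
      ((ha i (j + 1) (by omega) (by omega)).sub ha0)).continuousAt
  have hc0 : quadDet (F 0) i j = quadDet f i j := by
    simp only [quadDet, h0 i j (by omega) (by omega), h0 (i + 1) j (by omega) (by omega),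
      h0 (i + 1) (j + 1) (by omega) (by omega), h0 i (j + 1) (by omega) (by omega)]
  by_cases hd : quadDet f i j = 0
  · filter_upwards [hq] with s hs
    refine hs.quadCompat ?_
    have : quadDet (F s) i j ^ 2 = quadDet f i j ^ 2 := hs.det3_sq
    rw [hd] at this ⊢
    simpa using this
  · have hpos : ∀ᶠ s in 𝓝 0, 0 < quadDet (F s) i j * quadDet f i j :=
      (hc.mul continuousAt_const).eventually_const_lt (by
        simp only [Pi.mul_apply, hc0]; exact mul_self_pos.2 hd)
    filter_upwards [hq, hpos] with s hs hp
    refine hs.quadCompat (eq_of_sq_eq_of_mul_pos ?_ hp)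
    have : quadDet (F s) i j ^ 2 = quadDet f i j ^ 2 := hs.det3_sq
    rwa [sq, sq] at this

lemma eventually_starDet_pos (ha : ∀ k l, k ≤ i + 2 → l ≤ j + 2 → AnalyticCurve fun s => F s k l)
    (h0 : ∀ k l, k ≤ i + 2 → l ≤ j + 2 → F 0 k l = f k l) (hd : ∀ k, starDet f i j k ≠ 0) :
    ∀ᶠ s in 𝓝 0, ∀ k, 0 < starDet (F s) i j k * starDet f i j k := by
  have he : ∀ k, AnalyticCurve fun s => starEdge (F s) i j k := by
    have hc := ha (i + 1) (j + 1) (by omega) (by omega)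
    intro k
    fin_cases k
    · exact (ha (i + 2) (j + 1) (by omega) (by omega)).sub hc
    · exact (ha (i + 1) (j + 2) (by omega) (by omega)).sub hc
    · exact (ha i (j + 1) (by omega) (by omega)).sub hc
    · exact (ha (i + 1) j (by omega) (by omega)).sub hc
  have he0 : starEdge (F 0) i j = starEdge f i j := by
    simp only [starEdge, h0 (i + 1) (j + 1) (by omega) (by omega),
      h0 (i + 2) (j + 1) (by omega) (by omega), h0 (i + 1) (j + 2) (by omega) (by omega),
      h0 i (j + 1) (by omega) (by omega), h0 (i + 1) j (by omega) (by omega)]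
  rw [eventually_all]
  intro k
  refine (((he k).det3 (he (k + 1)) (he (k + 2))).continuousAt.mul
    continuousAt_const).eventually_const_lt ?_
  simp only [Pi.mul_apply, he0]
  exact mul_self_pos.2 (hd k)

end

section

variable {m n : ℕ} {f : Conf} {F : ℝ → Conf}

lemma Germ.eventually_compat (h : Germ m n f F)
    (hd : ∀ i j, i + 2 ≤ m → j + 2 ≤ n → ∀ k, starDet f i j k ≠ 0) :
    ∀ᶠ s in 𝓝 0, Compat m n (F s) f := by
  have hq := eventually_forall_lt_lt h.quad
  have hq' := eventually_forall_lt_lt fun i j (hi : i < m) (hj : j < n) =>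
    eventually_quadCompat (fun k l hk hl => h.analytic k l (by omega) (by omega))
      (fun k l hk hl => h.start k l (by omega) (by omega)) (h.quad i j hi hj)
  have hs := eventually_forall_lt_lt fun i j (hi : i < m - 1) (hj : j < n - 1) =>
    eventually_starDet_pos (fun k l hk hl => h.analytic k l (by omega) (by omega))
      (fun k l hk hl => h.start k l (by omega) (by omega)) (hd i j (by omega) (by omega))
  filter_upwards [hq, hq', hs] with s hq hq' hs
  exact ⟨hq', fun i j hi hj => starCompat_of_quadDist (hq _ _ (by omega) (by omega))
    (hq _ _ (by omega) (by omega)) (hq _ _ (by omega) (by omega)) (hq _ _ (by omega) (by omega))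
    (hs i j (by omega) (by omega))⟩

lemma Germ.rowDot_zero (h : Germ m n f F) {i j : ℕ} (hi : i + 2 ≤ m) (hj : j + 2 ≤ n) :
    rowDot (F 0) i j = rowDot f i j := by
  simp only [rowDot, h.start (i + 2) (j + 1) hi (by omega),
    h.start (i + 1) (j + 1) (by omega) (by omega), h.start i (j + 1) (by omega) (by omega)]

/-- Along an analytic deformation, the angle at any inner vertex takes all values close to the
initial one. -/
theorem Germ.exists_rowDot_eq (h : Germ m n f F)
    (hd : ∀ i j, i + 2 ≤ m → j + 2 ≤ n → ∀ k, starDet f i j k ≠ 0) {i j : ℕ} (hi : i + 2 ≤ m)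
    (hj : j + 2 ≤ n) {ε : ℝ} (hε : 0 < ε) :
    ∃ η > 0, ∀ y, |y - rowDot f i j| < η → ∃ s, |s| < ε ∧ rowDot (F s) i j = y := by
  have hX : AnalyticAt ℝ (fun s => rowDot (F s) i j) 0 := by
    have hc := h.analytic (i + 1) (j + 1) (by omega) (by omega)
    exact ((h.analytic (i + 2) (j + 1) hi (by omega)).sub hc).dot
      ((h.analytic i (j + 1) (by omega) (by omega)).sub hc)
  have hev := (h.eventually_compat hd).and (h.param.and
    (hX.eventually_analyticAt.mono fun s hs => hs.continuousAt))
  obtain ⟨δ, hδ, hball⟩ := Metric.eventually_nhds_iff.1 hev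
  simp only [Real.dist_eq, sub_zero] at hball
  set r := min δ ε / 2 with hr
  have hr0 : 0 < r := by positivity
  have hrδ : r < δ := by
    have := min_le_left δ ε; have : 0 < min δ ε := by positivity
    linarith
  have hrε : r < ε := by
    have := min_le_right δ ε; have : 0 < min δ ε := by positivity
    linarith
  have hIcc : ∀ s ∈ Icc (-r) r, |s| < δ := fun s hs => (abs_le.2 hs).trans_lt hrδ
  have hcont : ContinuousOn (fun s => rowDot (F s) i j) (Icc (-r) r) := fun s hs =>
    (hball (hIcc s hs)).2.2.continuousWithinAt
  -- Members of the germ that agree in the angle at this vertex agree in the angle at `(1, 1)`,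
  -- which is the parameter up to a constant. A continuous injective function on an interval is
  -- strictly monotone, so its image contains a neighbourhood of the value at the interior point
  -- `0`.
  have hinj : InjOn (fun s => rowDot (F s) i j) (Icc (-r) r) := by
    intro s hs s' hs' e
    have h1 := hball (hIcc s hs)
    have h2 := hball (hIcc s' hs')
    have h3 := ((h1.1.trans h2.1.symm).rowDot_iff hi hj).2 e
    rw [h1.2.1, h2.2.1] at h3
    exact add_left_cancel h3
  have hX0 := h.rowDot_zero hi hj
  have hz : (0 : ℝ) ∈ Icc (-r) r := ⟨by linarith, hr0.le⟩
  have hl : -r ∈ Icc (-r) r := ⟨le_rfl, by linarith⟩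
  have hu : r ∈ Icc (-r) r := ⟨by linarith, le_rfl⟩
  have hlt : ∀ s ∈ Icc (-r) r, |s| < ε := fun s hs => (abs_le.2 hs).trans_lt hrε
  rcases hcont.strictMonoOn_of_injOn_Icc' (by linarith) hinj with hmono | hanti
  · have h1 := hmono hl hz (by linarith)
    have h2 := hmono hz hu hr0
    simp only [hX0] at h1 h2
    refine ⟨min (rowDot f i j - rowDot (F (-r)) i j) (rowDot (F r) i j - rowDot f i j),
      lt_min (by linarith) (by linarith), fun y hy => ?_⟩
    obtain ⟨hy1, hy2⟩ := lt_min_iff.1 hy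
    rw [abs_lt] at hy1 hy2
    obtain ⟨s, hs, rfl⟩ := intermediate_value_Icc (by linarith) hcont
      (show y ∈ Icc _ _ from ⟨by linarith, by linarith⟩)
    exact ⟨s, hlt s hs, rfl⟩
  · have h1 := hanti hl hz (by linarith)
    have h2 := hanti hz hu hr0
    simp only [hX0] at h1 h2
    refine ⟨min (rowDot (F (-r)) i j - rowDot f i j) (rowDot f i j - rowDot (F r) i j),
      lt_min (by linarith) (by linarith), fun y hy => ?_⟩
    obtain ⟨hy1, hy2⟩ := lt_min_iff.1 hy
    rw [abs_lt] at hy1 hy2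
    obtain ⟨s, hs, rfl⟩ := intermediate_value_Icc' (by linarith) hcont
      (show y ∈ Icc _ _ from ⟨by linarith, by linarith⟩)
    exact ⟨s, hlt s hs, rfl⟩

end

/-! ### Closing a new row by means of the building blocks -/

/-- The grid with the vertex `(a, b)` as origin. -/
def shift (a b : ℕ) (g : Conf) : Conf := fun i j => g (a + i) (b + j)

lemma StarCompat.congr {g g' h h' : Conf} {i j : ℕ} (hs : StarCompat g g' i j)
    (hg : ∀ k l, k ≤ i + 2 → l ≤ j + 2 → g k l = h k l)
    (hg' : ∀ k l, k ≤ i + 2 → l ≤ j + 2 → g' k l = h' k l) : StarCompat h h' i j := by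
  unfold StarCompat at hs ⊢
  rw [← hg _ _ le_rfl (by omega), ← hg _ _ (by omega) (by omega), ← hg _ _ (by omega) le_rfl,
    ← hg i _ (by omega) (by omega), ← hg _ j (by omega) (by omega),
    ← hg' _ _ le_rfl (by omega), ← hg' _ _ (by omega) (by omega), ← hg' _ _ (by omega) le_rfl,
    ← hg' i _ (by omega) (by omega), ← hg' _ j (by omega) (by omega)]
  exact hs

lemma QuadCompat.congr {g g' h h' : Conf} {i j : ℕ} (hs : QuadCompat g g' i j)
    (hg : ∀ k l, k ≤ i + 1 → l ≤ j + 1 → g k l = h k l)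
    (hg' : ∀ k l, k ≤ i + 1 → l ≤ j + 1 → g' k l = h' k l) : QuadCompat h h' i j := by
  unfold QuadCompat at hs ⊢
  rw [← hg i j (by omega) (by omega), ← hg _ j le_rfl (by omega), ← hg _ _ le_rfl le_rfl,
    ← hg i _ (by omega) le_rfl, ← hg' i j (by omega) (by omega), ← hg' _ j le_rfl (by omega),
    ← hg' _ _ le_rfl le_rfl, ← hg' i _ (by omega) le_rfl]
  exact hs

/-- The lengths and angles not covered by `RowCompat` belong to the two quads on the side of the
preceding row. -/
lemma RowCompat.starCompat {g g' : Conf} {i j : ℕ} (h : RowCompat g g' i j)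
    (h0 : QuadCompat g g' i j) (h1 : QuadCompat g g' i (j + 1))
    (hd : ∀ k, 0 < starDet g i j k * starDet g' i j k) : StarCompat g g' i j := by
  apply starCompat_of_dot_eq _ _ hd
  · intro k
    fin_cases k
    · exact h.self
    · exact h1.rotate.dot_qq
    · exact h0.rotate.rotate.dot_qq
    · exact h0.rotate.rotate.reverse.dot_qq
  · intro k
    fin_cases k
    · exact h.right
    · exact h1.rotate.dot_qs
    · exact h0.rotate.rotate.dot_qs
    · exact (dot_comm _ _).trans (h.left.trans (dot_comm _ _))

lemma toConf_buildingBlock {m n : ℕ} (f : QuadSurface m n) {a b : ℕ} (ha : a + 3 ≤ m)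
    (hb : b + 3 ≤ n) {i j : ℕ} (hi : i ≤ 3) (hj : j ≤ 3) :
    toConf (buildingBlock f a b ha hb) i j = shift a b (toConf f) i j := by
  rw [toConf_eq hi hj, shift, toConf_eq (by omega) (by omega)]
  rfl

/-- The edges between consecutive new vertices keep their lengths if the building blocks are
flexible. -/
theorem Germ.eventually_edge {m n : ℕ} {f : QuadSurface m n} (hf : NonDegenerate f) {k l : ℕ}
    (hk : k + 3 ≤ m) (hl : l + 2 = n) {F : ℝ → Conf} (h : Germ (k + 2) (l + 2) (toConf f) F)
    (ha : ∀ j ≤ l + 2, AnalyticCurve fun s => F s (k + 3) j)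
    (h0 : ∀ j ≤ l + 2, F 0 (k + 3) j = toConf f (k + 3) j)
    (hr : ∀ j ≤ l, ∀ᶠ s in 𝓝 0, RowCompat (F s) (toConf f) (k + 1) j)
    {j : ℕ} (hj : j + 1 ≤ l)
    (hflex : ContinuouslyFlexible (buildingBlock f k j hk (by omega))) :
    ∀ᶠ s in 𝓝 0, dot (F s (k + 3) (j + 1) - F s (k + 3) (j + 2))
      (F s (k + 3) (j + 1) - F s (k + 3) (j + 2)) =
      dot (toConf f (k + 3) (j + 1) - toConf f (k + 3) (j + 2))
        (toConf f (k + 3) (j + 1) - toConf f (k + 3) (j + 2)) := by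
  have hd : ∀ i j, i + 2 ≤ m → j + 2 ≤ n → ∀ k, starDet (toConf f) i j k ≠ 0 :=
    fun i j hi hj => hf.starDet_ne_zero hi hj
  have hC := h.eventually_compat fun i j hi hj => hd i j (by omega) (by omega)
  have ha' : ∀ i j, i ≤ k + 3 → j ≤ l + 2 → AnalyticCurve fun s => F s i j := by
    intro i j hi hj
    rcases (by omega : i ≤ k + 2 ∨ i = k + 3) with hi | rfl
    · exact h.analytic i j hi hj
    · exact ha j hj
  have h0' : ∀ i j, i ≤ k + 3 → j ≤ l + 2 → F 0 i j = toConf f i j := by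
    intro i j hi hj
    rcases (by omega : i ≤ k + 2 ∨ i = k + 3) with hi | rfl
    · exact h.start i j hi hj
    · exact h0 j hj
  have hS : ∀ i ≤ l, ∀ᶠ s in 𝓝 0, StarCompat (F s) (toConf f) (k + 1) i := by
    intro i hi
    filter_upwards [hC, hr i hi, eventually_starDet_pos (i := k + 1) (j := i)
      (fun a b ha hb => ha' a b ha (by omega)) (fun a b ha hb => h0' a b ha (by omega))
      (hd (k + 1) i (by omega) (by omega))] with s hC hr hd
    exact hr.starCompat (hC.quad _ _ (by omega) (by omega)) (hC.quad _ _ (by omega) (by omega)) hd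
  -- The last row of quads of the block, where rigidity is still to be proved, is not needed here;
  -- the stars take its place.
  have hskel : ∀ᶠ s in 𝓝 0, SkelCompat 3 3 (shift k j (F s)) (shift k j (toConf f)) := by
    filter_upwards [hC, hS j (by omega), hS (j + 1) hj] with s hC h1 h2
    refine ⟨fun i j' hi hj' => hC.quad (k + i) (j + j') (by omega) (by omega), fun i j' hi hj' => ?_⟩
    have hi : i < 2 := by omega
    have hj' : j' < 2 := by omega
    interval_cases i
    · exact hC.star (k + 0) (j + j') (by omega) (by omega)
    · interval_cases j'
      · exact h1
      · exact h2
  -- Identity theorem: it suffices to find parameters `s ≠ 0` arbitrarily close to `0` with the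
  -- right distance.
  rw [← AnalyticAt.frequently_eq_iff_eventually_eq
    (((ha (j + 1) (by omega)).sub (ha (j + 2) (by omega))).dot
      ((ha (j + 1) (by omega)).sub (ha (j + 2) (by omega)))) analyticAt_const]
  rw [Filter.Frequently, eventually_nhdsWithin_iff]
  intro hne
  obtain ⟨ε, hε, hball⟩ := Metric.eventually_nhds_iff.1 (hskel.and hne)
  simp only [Real.dist_eq, sub_zero] at hball
  obtain ⟨η, hη, hsurj⟩ := h.exists_rowDot_eq (fun i j hi hj => hd i j (by omega) (by omega))
    (i := k) (j := j) le_rfl (by omega) hε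
  obtain ⟨G, hG, hGc⟩ := hflex
  have hfB : NonDegenerate (buildingBlock f k j hk (by omega)) :=
    fun a b ha hb c => hf (k + a) (j + b) (by omega) (by omega) c
  have hshift : ∀ a b, a ≤ 3 → b ≤ 3 →
      toConf (buildingBlock f k j hk (by omega)) a b = shift k j (toConf f) a b :=
    fun a b ha hb => toConf_buildingBlock f hk (by omega) ha hb
  have hrow : rowDot (toConf (buildingBlock f k j hk (by omega))) 0 0 = rowDot (toConf f) k j := by
    simp only [rowDot, hshift _ _ (show 0 + 2 ≤ 3 by omega) (show 0 + 1 ≤ 3 by omega),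
      hshift _ _ (show 0 + 1 ≤ 3 by omega) (show 0 + 1 ≤ 3 by omega),
      hshift _ _ (show 0 ≤ 3 by omega) (show 0 + 1 ≤ 3 by omega)]
    rfl
  -- The motion of the block supplies an angle within `η` of the initial one but different from it,
  -- and the germ attains this angle at some `s` with `|s| < ε`.
  obtain ⟨t, ht, hCt, hxt, hlt⟩ := hG.exists_rowDot_ne hfB (by omega) (by omega) hGc (i₀ := 0)
    (j₀ := 0) (by omega) (by omega) hη
  rw [hrow] at hxt hlt
  obtain ⟨s, hs, hXs⟩ := hsurj _ hlt
  obtain ⟨hs1, hs2⟩ := hball hs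
  refine hs2 ?_ ?_
  · rintro rfl
    apply hxt
    rw [← hXs, h.rowDot_zero le_rfl (by omega)]
  -- Germ and block motion have equal angles, so the skeletons are congruent; in the block motion
  -- the disputed edge belongs to a rigid quad and has its original length.
  · have hcomp : SkelCompat 3 3 (shift k j (F s)) (toConf (G t)) := by
      refine hs1.trans ⟨fun a b ha hb => QuadCompat.congr (hCt.quad a b (by omega) hb).symm
        (fun c d hc hd => hshift c d (by omega) (by omega)) fun _ _ _ _ => rfl, fun a b ha hb =>
        StarCompat.congr (hCt.star a b ha hb).symm
          (fun c d hc hd => hshift c d (by omega) (by omega)) fun _ _ _ _ => rfl⟩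
    have h1 := hcomp.dot_eq (by omega) (by omega) hXs (i := 3) (j := 1) (k := 3) (l := 2) le_rfl
      (by omega) (by omega) le_rfl (by omega) (by omega)
    have h2 := (hCt.quad 2 1 (by omega) (by omega)).qr
    have h3 := h1.trans h2
    rw [hshift _ _ (by omega) (by omega), hshift _ _ (by omega) (by omega)] at h3
    exact h3

theorem Germ.succ_row {m n : ℕ} {f : QuadSurface m n} (hf : NonDegenerate f) {k l : ℕ}
    (hk : k + 3 ≤ m) (hl : l + 2 = n) {F : ℝ → Conf} (h : Germ (k + 2) (l + 2) (toConf f) F)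
    (hflex : ∀ (a b : ℕ) (ha : a + 3 ≤ m) (hb : b + 3 ≤ n),
      ContinuouslyFlexible (buildingBlock f a b ha hb)) :
    ∃ F', Germ (k + 3) (l + 2) (toConf f) F' := by
  obtain ⟨F', hold, ha, h0, hr, hq0, hq1⟩ := h.exists_succ_row
    fun j hj => hf.starDet_ne_zero (i := k + 1) (j := j) (by omega) (by omega) 3
  have h' : Germ (k + 2) (l + 2) (toConf f) F' := by
    refine ⟨fun i j hi hj => ?_, fun i j hi hj => ?_, fun i j hi hj => ?_, ?_⟩
    · simp only [hold _ _ _ hi]; exact h.analytic i j hi hj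
    · rw [hold _ _ _ hi]; exact h.start i j hi hj
    · simp only [QuadDist, hold _ i _ hi.le, hold _ (i + 1) _ hi]; exact h.quad i j hi hj
    · simp only [rowDot, hold _ (0 + 2) _ (by omega), hold _ (0 + 1) _ (by omega),
        hold _ 0 _ (by omega)]
      exact h.param
  refine ⟨F', fun i j hi hj => ?_, fun i j hi hj => ?_, fun i j hi hj => ?_, h'.param⟩
  · rcases (by omega : i ≤ k + 2 ∨ i = k + 3) with hi | rfl
    · exact h'.analytic i j hi hj
    · exact ha j hj
  · rcases (by omega : i ≤ k + 2 ∨ i = k + 3) with hi | rfl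
    · exact h'.start i j hi hj
    · exact h0 j hj
  · rcases (by omega : i < k + 2 ∨ i = k + 2) with hi | rfl
    · exact h'.quad i j hi hj
    · rcases (by omega : j = 0 ∨ j = l + 1 ∨ 0 < j ∧ j ≤ l) with rfl | rfl | ⟨hj0, hjl⟩
      · exact hq0
      · exact hq1
      · obtain ⟨j, rfl⟩ := Nat.exists_eq_succ_of_ne_zero hj0.ne'
        -- Of the six distances of an inner quad, the edge between the two new vertices is given by
        -- `e`. Both diagonals follow from the lengths and angles at the two vertices of the
        -- previous row.
        filter_upwards [hr j (by omega), hr (j + 1) hjl, h'.quad (k + 1) (j + 1) (by omega) (by omega),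
          h'.quad (k + 1) j (by omega) (by omega),
          h'.eventually_edge hf hk hl ha h0 hr hjl (hflex k j hk (by omega))] with s r1 r2 q q0 e
        have c1 : dot (F' s (k + 2) (j + 2) - F' s (k + 2) (j + 1))
            (F' s (k + 2) (j + 2) - F' s (k + 2) (j + 1)) =
            dot (toConf f (k + 2) (j + 2) - toConf f (k + 2) (j + 1))
            (toConf f (k + 2) (j + 2) - toConf f (k + 2) (j + 1)) := q.rotate.dot_qq
        refine ⟨?_, ?_, ?_, e, ?_, ?_⟩
        · rw [dot_sub_comm]; refine r1.self.trans ?_; rw [dot_sub_comm]; rfl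
        · exact dot_sub_eq_of_dot_eq q.rotate.pq r2.self
            ((dot_comm _ _).trans (r2.left.trans (dot_comm _ _)))
        · rw [dot_sub_comm]; refine c1.trans ?_; rw [dot_sub_comm]
        · exact dot_sub_eq_of_dot_eq r1.self c1 r1.right
        · exact r2.self

/-- For `m = 2` no row is added, and for `n = 2` a new row has only its two end quads, so the
absence of blocks does no harm. -/
theorem exists_germ {m n : ℕ} (hm : 2 ≤ m) (hn : 2 ≤ n) {f : QuadSurface m n}
    (hf : NonDegenerate f) (hflex : ∀ (a b : ℕ) (ha : a + 3 ≤ m) (hb : b + 3 ≤ n),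
      ContinuouslyFlexible (buildingBlock f a b ha hb)) :
    ∃ F, Germ m n (toConf f) F := by
  have cols : ∀ k, k + 1 ≤ n → ∃ F, Germ 2 (k + 1) (toConf f) F := by
    intro k
    induction k with
    | zero => intro _; exact exists_germ_two_one (hf.starDet_ne_zero hm hn 2)
    | succ k ih =>
      intro hk
      obtain ⟨F, hF⟩ := ih (by omega)
      exact hF.succ_col (hf.starDet_ne_zero hm hk 0)
  obtain ⟨l, hl⟩ : ∃ l, l + 2 = n := ⟨n - 2, by omega⟩
  have rows : ∀ k, k + 2 ≤ m → ∃ F, Germ (k + 2) (l + 2) (toConf f) F := by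
    intro k
    induction k with
    | zero => intro _; exact cols (l + 1) (by omega)
    | succ k ih =>
      intro hk
      obtain ⟨F, hF⟩ := ih (by omega)
      exact hF.succ_row hf hk hl hflex
  obtain ⟨F, hF⟩ := rows (m - 2) (by omega)
  rw [hl, show m - 2 + 2 = m by omega] at hF
  exact ⟨F, hF⟩

/-! ### From deformations to motions, and restriction to blocks -/

lemma QuadDist.dot_eq {g g' : Conf} {i j : ℕ} (h : QuadDist g g' i j) {k l k' l' : ℕ}
    (hk : k = i ∨ k = i + 1) (hl : l = j ∨ l = j + 1) (hk' : k' = i ∨ k' = i + 1)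
    (hl' : l' = j ∨ l' = j + 1) :
    dot (g k l - g k' l') (g k l - g k' l') = dot (g' k l - g' k' l') (g' k l - g' k' l') := by
  have symm : ∀ {p q p' q' : E3}, dot (p - q) (p - q) = dot (p' - q') (p' - q') →
      dot (q - p) (q - p) = dot (q' - p') (q' - p') := by
    intro p q p' q' e
    rw [dot_sub_comm, e, dot_sub_comm]
  rcases hk with rfl | rfl <;> rcases hl with rfl | rfl <;> rcases hk' with rfl | rfl <;>
    rcases hl' with rfl | rfl
  · simp only [sub_self]
  · exact h.ps
  · exact h.pq
  · exact h.pr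
  · exact symm h.ps
  · simp only [sub_self]
  · exact symm h.qs
  · exact symm h.rs
  · exact symm h.pq
  · exact h.qs
  · simp only [sub_self]
  · exact h.qr
  · exact symm h.pr
  · exact h.rs
  · exact symm h.qr
  · simp only [sub_self]

lemma rowDot_eq_of_isCongruent {m n : ℕ} {f g : QuadSurface m n} (h : IsCongruent f g) (i j : ℕ) :
    rowDot (toConf f) i j = rowDot (toConf g) i j := by
  have key : ∀ i j k l, dot (toConf f i j - toConf f k l) (toConf f i j - toConf f k l) =
      dot (toConf g i j - toConf g k l) (toConf g i j - toConf g k l) :=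
    fun i j k l => dist_eq_dist_iff.1 (h _ _)
  rw [rowDot, rowDot, dot_sub_sub_eq, dot_sub_sub_eq (toConf g (i + 1) (j + 1)), key, key, key]

lemma Germ.continuouslyFlexible {m n : ℕ} {f : QuadSurface m n} (hm : 2 ≤ m) (hn : 2 ≤ n)
    {F : ℝ → Conf} (h : Germ m n (toConf f) F) : ContinuouslyFlexible f := by
  have hc := eventually_forall_lt_lt (m := m + 1) (n := n + 1) fun i j hi hj =>
    (h.analytic i j (by omega) (by omega)).eventually_continuousAt
  have hev := (eventually_forall_lt_lt h.quad).and (h.param.and hc)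
  obtain ⟨δ, hδ, hball⟩ := Metric.eventually_nhds_iff.1 hev
  simp only [Real.dist_eq, sub_zero] at hball
  have hlt : ∀ t ∈ Icc (0 : ℝ) 1, |δ / 2 * t| < δ := by
    intro t ht
    rw [abs_of_nonneg (mul_nonneg (by positivity) ht.1)]
    nlinarith [ht.2]
  have hval : ∀ s, ∀ i j, i ≤ m → j ≤ n →
      toConf (fun p : Fin (m + 1) × Fin (n + 1) => F s p.1 p.2) i j = F s i j := by
    intro s i j hi hj
    rw [toConf_eq hi hj]
  -- The factor `δ / 2` keeps the parameter inside the good ball for all `t` in `[0, 1]`. At `t = 1`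
  -- the angle at `(1, 1)` has changed by `δ / 2`, so the motion is nontrivial.
  refine ⟨fun t p => F (δ / 2 * t) p.1 p.2, ⟨?_, ?_, ?_⟩, 1, right_mem_Icc.2 zero_le_one, ?_⟩
  · refine continuousOn_pi.2 fun p t ht => ContinuousAt.continuousWithinAt ?_
    have h1 := (hball (hlt t ht)).2.2 p.1 p.2 p.1.2 p.2.2
    exact ContinuousAt.comp (f := fun t : ℝ => δ / 2 * t) (g := fun s => F s p.1 p.2) h1
      (by fun_prop)
  · funext p
    rw [mul_zero, h.start _ _ (by omega) (by omega), toConf_val]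
  · rintro t ht i j p ⟨hp1, hp2⟩ q ⟨hq1, hq2⟩
    have hq := (hball (hlt t ht)).1 i j i.2 j.2
    rw [← toConf_val (f := f) p, ← toConf_val (f := f) q, dist_eq_dist_iff]
    refine hq.dot_eq ?_ ?_ ?_ ?_
    · exact hp1.imp (congrArg Fin.val) (congrArg Fin.val)
    · exact hp2.imp (congrArg Fin.val) (congrArg Fin.val)
    · exact hq1.imp (congrArg Fin.val) (congrArg Fin.val)
    · exact hq2.imp (congrArg Fin.val) (congrArg Fin.val)
  · intro hcon
    have h1 := rowDot_eq_of_isCongruent hcon 0 0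
    have h2 := (hball (hlt 1 (right_mem_Icc.2 zero_le_one))).2.1
    have h3 : rowDot (toConf fun p : Fin (m + 1) × Fin (n + 1) => F (δ / 2 * 1) p.1 p.2) 0 0 =
        rowDot (F (δ / 2 * 1)) 0 0 := by
      simp only [rowDot, hval _ (0 + 2) (0 + 1) (by omega) (by omega),
        hval _ (0 + 1) (0 + 1) (by omega) (by omega), hval _ 0 (0 + 1) (by omega) (by omega)]
    rw [h3, h2] at h1
    linarith

lemma continuouslyFlexible_buildingBlock {m n : ℕ} {f : QuadSurface m n} (hf : NonDegenerate f)
    (h : ContinuouslyFlexible f) (a b : ℕ) (ha : a + 3 ≤ m) (hb : b + 3 ≤ n) :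
    ContinuouslyFlexible (buildingBlock f a b ha hb) := by
  obtain ⟨F, hF, hc⟩ := h
  -- The angle at the inner vertex `(a + 1, b + 1)`, which is also inner in the block, changes; the
  -- closeness bound plays no role here.
  obtain ⟨t, ht, -, hne, -⟩ := hF.exists_rowDot_ne hf (by omega) (by omega) hc (i₀ := a) (j₀ := b)
    (by omega) (by omega) one_pos
  refine ⟨fun t => buildingBlock (F t) a b ha hb, ⟨?_, ?_, ?_⟩, t, ht, ?_⟩
  · exact continuousOn_pi.2 fun p => continuousOn_pi.1 hF.continuousOn _
  · simp only [hF.start]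
  · rintro t ht i j p ⟨hp1, hp2⟩ q ⟨hq1, hq2⟩
    refine hF.rigid t ht ⟨a + i, by omega⟩ ⟨b + j, by omega⟩ _ ⟨?_, ?_⟩ _ ⟨?_, ?_⟩
    · exact hp1.imp (fun e => by simp [e]) (fun e => by simp [e, add_assoc])
    · exact hp2.imp (fun e => by simp [e]) (fun e => by simp [e, add_assoc])
    · exact hq1.imp (fun e => by simp [e]) (fun e => by simp [e, add_assoc])
    · exact hq2.imp (fun e => by simp [e]) (fun e => by simp [e, add_assoc])
  · intro hcon
    apply hne
    have h1 := rowDot_eq_of_isCongruent hcon 0 0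
    have e : ∀ g : QuadSurface m n,
        rowDot (toConf (buildingBlock g a b ha hb)) 0 0 = rowDot (toConf g) a b := by
      intro g
      simp only [rowDot, toConf_buildingBlock g ha hb (show 0 + 2 ≤ 3 by omega)
          (show 0 + 1 ≤ 3 by omega),
        toConf_buildingBlock g ha hb (show 0 + 1 ≤ 3 by omega) (show 0 + 1 ≤ 3 by omega),
        toConf_buildingBlock g ha hb (show 0 ≤ 3 by omega) (show 0 + 1 ≤ 3 by omega)]
      rfl
    rwa [e, e] at h1

end SkewQuad

theorem theorem3 (m n : ℕ) (hm : 2 ≤ m) (hn : 2 ≤ n) (f : QuadSurface m n)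
    (hf : NonDegenerate f) :
    ContinuouslyFlexible f ↔
      ∀ (a b : ℕ) (ha : a + 3 ≤ m) (hb : b + 3 ≤ n),
        ContinuouslyFlexible (buildingBlock f a b ha hb) := by
  refine ⟨SkewQuad.continuouslyFlexible_buildingBlock hf, fun h => ?_⟩
  obtain ⟨F, hF⟩ := SkewQuad.exists_germ hm hn hf h
  exact hF.continuouslyFlexible hm hn
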